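/- Let $N$ be a simply-connected (in particular connected) nilpotent real Lie group and let $\Gamma \leq N$ be a lattice, i.e. a discrete subgroup such that $N/\Gamma$ carries a nonzero finite $N$-invariant Borel measure. A partial automorphism of $\Gamma$ is an isomorphism $\phi : \Gamma_1 \to \Gamma_2$ between finite index subgroups of $\Gamma$; two partial automorphisms are equivalent if they agree on some finite index subgroup of $\Gamma$ on which both are defined, and the equivalence classes $[\phi]$ are the elements of the abstract commensurator $\mathrm{Comm}(\Gamma)$. Two subgroups of $\Gamma$ are commensurable if their intersection has finite index in both; $[\Delta]$ denotes the commensurability class of $\Delta \leq \Gamma$, and $\mathrm{Comm}(\Gamma)$ acts on these classes by $[\phi]\cdot[\Delta] = [\phi(\Gamma_1 \cap \Delta)]$. A subgroup $\Delta \leq \Gamma$ is called commensuristic if $[\phi]\cdot[\Delta] = [\Delta]$ for every $[\phi] \in \mathrm{Comm}(\Gamma)$, and strongly commensuristic if $\phi(\Gamma_1 \cap \Delta) = \Gamma_2 \cap \Delta$ for every partial automorphism $\phi : \Gamma_1 \to \Gamma_2$ of $\Gamma$. Let $\gamma^0(\Gamma) = 1$ and let $\gamma^{k+1}(\Gamma)$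 be the preimage in $\Gamma$ of the center of $\Gamma/\gamma^k(\Gamma)$ (the upper central series); let $\gamma_0(\Gamma) = \Gamma$ and $\gamma_{k+1}(\Gamma) = [\Gamma, \gamma_k(\Gamma)]$ (the lower central series). Then, for every integer $k \geq 0$: 1. $\gamma^k(\Gamma)$ is strongly commensuristic in $\Gamma$; 2. $\gamma_k(\Gamma)$ is commensuristic in $\Gamma$. -/

import Mathlib

open scoped Manifold ContDiff

/-- A partial automorphism of a group `Γ`: an isomorphism between two subgroups of finite index. -/
structure PartialAut (Γ : Type*) [Group Γ] where
  source : Subgroup Γ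
  target : Subgroup Γ
  source_finiteIndex : source.FiniteIndex
  target_finiteIndex : target.FiniteIndex
  toEquiv : source ≃* target

namespace PartialAut

variable {Γ : Type*} [Group Γ]

/-- The partial automorphism `φ : Γ₁ → Γ₂`, regarded as a homomorphism `Γ₁ → Γ`. -/
def toHom (φ : PartialAut Γ) : φ.source →* Γ :=
  φ.target.subtype.comp φ.toEquiv.toMonoidHom

theorem toHom_injective (φ : PartialAut Γ) : Function.Injective φ.toHom :=
  φ.target.subtype_injective.comp φ.toEquiv.injective

/-- The subgroup `φ(Γ₁ ∩ Δ)` of `Γ`, for a partial automorphism `φ : Γ₁ → Γ₂`. -/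
def image (φ : PartialAut Γ) (Δ : Subgroup Γ) : Subgroup Γ :=
  (Δ.subgroupOf φ.source).map φ.toHom

/-- Two partial automorphisms are equivalent if they are both defined, and agree, on some
subgroup of finite index. -/
def Equivalent (φ ψ : PartialAut Γ) : Prop :=
  ∃ Γ₃ : Subgroup Γ, Γ₃.FiniteIndex ∧ ∃ (h₁ : Γ₃ ≤ φ.source) (h₂ : Γ₃ ≤ ψ.source),
    ∀ (x : Γ) (hx : x ∈ Γ₃), φ.toHom ⟨x, h₁ hx⟩ = ψ.toHom ⟨x, h₂ hx⟩

theorem equivalent_equivalence : Equivalence (Equivalent (Γ := Γ)) where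
  refl φ := ⟨φ.source, φ.source_finiteIndex, le_rfl, le_rfl, fun _ _ => rfl⟩
  symm := fun ⟨K, hK, h₁, h₂, h⟩ => ⟨K, hK, h₂, h₁, fun x hx => (h x hx).symm⟩
  trans := fun ⟨K, _, h₁, _, h⟩ ⟨L, _, _, k₂, k⟩ =>
    ⟨K ⊓ L, inferInstance, inf_le_left.trans h₁, inf_le_right.trans k₂,
      fun x hx => (h x hx.1).trans (k x hx.2)⟩

/-- The equivalence relation on partial automorphisms. -/
instance setoid (Γ : Type*) [Group Γ] : Setoid (PartialAut Γ) :=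
  ⟨Equivalent, equivalent_equivalence⟩

theorem image_commensurable (φ : PartialAut Γ) {Δ Δ' : Subgroup Γ}
    (h : Subgroup.Commensurable Δ Δ') :
    Subgroup.Commensurable (φ.image Δ) (φ.image Δ') := by
  constructor
  · rw [image, image, Subgroup.relIndex_map_map_of_injective _ _ φ.toHom_injective]
    exact Subgroup.relIndex_comap_ne_zero _ h.1
  · rw [image, image, Subgroup.relIndex_map_map_of_injective _ _ φ.toHom_injective]
    exact Subgroup.relIndex_comap_ne_zero _ h.2

theorem commensurable_inf_right (Δ K : Subgroup Γ) [K.FiniteIndex] :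
    Subgroup.Commensurable Δ (Δ ⊓ K) := by
  constructor
  · rw [Subgroup.relIndex_eq_one.mpr inf_le_left]
    exact one_ne_zero
  · rw [Subgroup.inf_relIndex_left]
    exact fun h => Subgroup.FiniteIndex.index_ne_zero (Subgroup.index_eq_zero_of_relIndex_eq_zero h)

theorem image_le_of_agree {φ ψ : PartialAut Γ} {K : Subgroup Γ} (h₁ : K ≤ φ.source)
    (h₂ : K ≤ ψ.source) (h : ∀ (x : Γ) (hx : x ∈ K), φ.toHom ⟨x, h₁ hx⟩ = ψ.toHom ⟨x, h₂ hx⟩)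
    (Δ : Subgroup Γ) : φ.image (Δ ⊓ K) ≤ ψ.image (Δ ⊓ K) := by
  rintro _ ⟨⟨x, hx⟩, hxK, rfl⟩
  have hxK' : x ∈ Δ ⊓ K := hxK
  exact ⟨⟨x, h₂ hxK'.2⟩, hxK', (h x hxK'.2).symm⟩

theorem image_commensurable_of_equivalent {φ ψ : PartialAut Γ} (hφ : Equivalent φ ψ)
    {Δ Δ' : Subgroup Γ} (hΔ : Subgroup.Commensurable Δ Δ') :
    Subgroup.Commensurable (φ.image Δ) (ψ.image Δ') := by
  obtain ⟨K, hK, h₁, h₂, h⟩ := hφ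
  have e : φ.image (Δ ⊓ K) = ψ.image (Δ ⊓ K) :=
    le_antisymm (image_le_of_agree h₁ h₂ h Δ)
      (image_le_of_agree h₂ h₁ (fun x hx => (h x hx).symm) Δ)
  have a := φ.image_commensurable (commensurable_inf_right Δ K)
  rw [e] at a
  exact (a.trans (ψ.image_commensurable (commensurable_inf_right Δ K)).symm).trans
    (ψ.image_commensurable hΔ)

end PartialAut

/-- The commensurations of `Γ`, i.e. the elements of the abstract commensurator `Comm(Γ)`:
equivalence classes of partial automorphisms. -/
def Commensuration (Γ : Type*) [Group Γ] : Type _ :=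
  Quotient (PartialAut.setoid Γ)

/-- Commensurability as an equivalence relation on the subgroups of `Γ`. -/
def commensurableSetoid (Γ : Type*) [Group Γ] : Setoid (Subgroup Γ) :=
  ⟨Subgroup.Commensurable, Subgroup.Commensurable.equivalence⟩

/-- The commensurability classes of subgroups of `Γ`. -/
def CommensurabilityClass (Γ : Type*) [Group Γ] : Type _ :=
  Quotient (commensurableSetoid Γ)

/-- The commensurability class `[Δ]` of a subgroup `Δ ≤ Γ`. -/
def Subgroup.commensurabilityClass {Γ : Type*} [Group Γ] (Δ : Subgroup Γ) :
    CommensurabilityClass Γ :=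
  Quotient.mk (commensurableSetoid Γ) Δ

/-- The action of commensurations on commensurability classes, `[φ] • [Δ] = [φ(Γ₁ ∩ Δ)]`. -/
instance Commensuration.instSMul (Γ : Type*) [Group Γ] :
    SMul (Commensuration Γ) (CommensurabilityClass Γ) where
  smul := Quotient.map₂ PartialAut.image fun _ _ hφ _ _ hΔ =>
    PartialAut.image_commensurable_of_equivalent hφ hΔ

/-- A subgroup `Δ ≤ Γ` is commensuristic if every commensuration of `Γ` fixes `[Δ]`. -/
def Subgroup.IsCommensuristic {Γ : Type*} [Group Γ] (Δ : Subgroup Γ) : Prop :=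
  ∀ c : Commensuration Γ, c • Δ.commensurabilityClass = Δ.commensurabilityClass

/-- A subgroup `Λ ≤ Γ` is strongly commensuristic if `φ(Γ₁ ∩ Λ) = Γ₂ ∩ Λ` for every partial
automorphism `φ : Γ₁ → Γ₂` of `Γ`. -/
def Subgroup.IsStronglyCommensuristic {Γ : Type*} [Group Γ] (Λ : Subgroup Γ) : Prop :=
  ∀ φ : PartialAut Γ, φ.image Λ = φ.target ⊓ Λ

/-- Unfolding of the definition of commensuristic subgroups. -/
theorem Subgroup.isCommensuristic_iff {Γ : Type*} [Group Γ] (Δ : Subgroup Γ) :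
    Δ.IsCommensuristic ↔ ∀ φ : PartialAut Γ, Subgroup.Commensurable (φ.image Δ) Δ :=
  ⟨fun h φ => Quotient.exact (s := commensurableSetoid Γ) (h (Quotient.mk _ φ)),
    fun h c => Quotient.inductionOn c fun φ => Quotient.sound (s := commensurableSetoid Γ) (h φ)⟩

/-- A lattice in a topological group `G`: a discrete subgroup `Γ` such that `G ⧸ Γ` carries a
nonzero finite `G`-invariant Borel measure. -/
structure Subgroup.IsLatticeIn {G : Type*} [Group G] [TopologicalSpace G] (Γ : Subgroup G) :
    Prop where
  discrete : DiscreteTopology Γ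
  exists_invariant_measure : ∃ μ : @MeasureTheory.Measure (G ⧸ Γ) (borel (G ⧸ Γ)),
    μ ≠ 0 ∧ μ Set.univ < ⊤ ∧ MeasureTheory.SMulInvariantMeasure G (G ⧸ Γ) μ

/-! Two properties of `Γ` suffice: it is a torsion-free nilpotent group, and all its subgroups are
finitely generated.

Torsion-freeness passes to the quotients of the upper central series. For `H` of finite index every
`g` has a power `g ^ n` in `H`, and `⁅x, g ^ n⁆` agrees with `⁅x, g⁆ ^ n` one stage below `⁅x, g⁆`;
so centrality tested on `H` implies centrality tested on the whole group, and the upper central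
series of `H` is induced (`upperCentralSeries_subgroupOf_eq`). As isomorphisms respect that series,
the first claim follows.

For the lower series, the same power identity shows that replacing `A` by a subgroup of finite index
changes `⁅A, B⁆` by torsion layers only; these are finitely generated abelian, hence finite
(`relIndex_commutator_ne_zero_left`). So the lower central series of `H` is commensurable with that
of the group.

Both properties of `Γ` come from a bijective exponential map of `N`. If `exp x` has finite order, a
nonzero multiple of `x` vanishes. The logarithms of an abelian subgroup of `Γ` form a discrete
subgroup of a finite-dimensional space, so abelian subgroups are finitely generated, and
`Subgroup.fg_of_forall_abelian_fg` extends this to all subgroups.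

The exponential is built by linearizing the squaring map at the identity and extending by repeated
doubling. A map that commutes with doubling is determined by its derivative at `0`
(`HasTangent.eq_exp`), which yields the usual identities. Nilpotency makes `Ad` unipotent, so the
differential of `exp` is an invertible polynomial in `Ad`; hence `exp` is a covering map, injective
since `N` is simply connected. -/

open scoped commutatorElement

/-! ### Upper central series of finite index subgroups of torsion-free nilpotent groups -/

section CommutatorPowers

variable {G : Type*} [Group G]

theorem commutatorElement_pow_left_of_commute {x g : G} (h : Commute ⁅x, g⁆ x) (n : ℕ) :
    ⁅x ^ n, g⁆ = ⁅x, g⁆ ^ n := by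
  induction n with
  | zero => simp
  | succ n ih =>
    have h1 : ⁅x ^ (n + 1), g⁆ = x * ⁅x ^ n, g⁆ * x⁻¹ * ⁅x, g⁆ := by
      simp only [commutatorElement_def, pow_succ']; group
    have h2 : x * ⁅x, g⁆ ^ n * x⁻¹ = ⁅x, g⁆ ^ n := by
      rw [← (h.pow_left n).eq, mul_inv_cancel_right]
    rw [h1, ih, h2, pow_succ]

theorem commutatorElement_pow_right_of_commute {x g : G} (h : Commute ⁅x, g⁆ g) (n : ℕ) :
    ⁅x, g ^ n⁆ = ⁅x, g⁆ ^ n := by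
  have h' : Commute ⁅g, x⁆ g := by
    rw [← commutatorElement_inv]; exact h.inv_left
  rw [← commutatorElement_inv, commutatorElement_pow_left_of_commute h', ← inv_pow,
    commutatorElement_inv]

theorem commute_mk_of_mem_upperCentralSeries_succ {i : ℕ} {c : G}
    (hc : c ∈ Subgroup.upperCentralSeries G (i + 1)) (x : G) :
    Commute (c : G ⧸ Subgroup.upperCentralSeries G i) x := by
  rw [← commutatorElement_eq_one_iff_commute, ← QuotientGroup.mk'_apply, ← QuotientGroup.mk'_apply,
    ← map_commutatorElement, QuotientGroup.mk'_apply, QuotientGroup.eq_one_iff]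
  exact Subgroup.mem_upperCentralSeries_succ_iff.1 hc x

theorem commutatorElement_pow_left_mem_iff {i : ℕ} {x g : G}
    (hc : ⁅x, g⁆ ∈ Subgroup.upperCentralSeries G (i + 1)) (n : ℕ) :
    ⁅x ^ n, g⁆ ∈ Subgroup.upperCentralSeries G i ↔
      ⁅x, g⁆ ^ n ∈ Subgroup.upperCentralSeries G i := by
  have h := commute_mk_of_mem_upperCentralSeries_succ hc x
  rw [← QuotientGroup.mk'_apply, map_commutatorElement] at h
  rw [← QuotientGroup.eq_one_iff, ← QuotientGroup.eq_one_iff, ← QuotientGroup.mk'_apply,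
    ← QuotientGroup.mk'_apply, map_commutatorElement, map_pow, map_pow, map_commutatorElement,
    commutatorElement_pow_left_of_commute h]

theorem commutatorElement_pow_right_mem_iff {i : ℕ} {x g : G}
    (hc : ⁅x, g⁆ ∈ Subgroup.upperCentralSeries G (i + 1)) (n : ℕ) :
    ⁅x, g ^ n⁆ ∈ Subgroup.upperCentralSeries G i ↔
      ⁅x, g⁆ ^ n ∈ Subgroup.upperCentralSeries G i := by
  have h := commute_mk_of_mem_upperCentralSeries_succ hc g
  rw [← QuotientGroup.mk'_apply, map_commutatorElement] at h
  rw [← QuotientGroup.eq_one_iff, ← QuotientGroup.eq_one_iff, ← QuotientGroup.mk'_apply,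
    ← QuotientGroup.mk'_apply, map_commutatorElement, map_pow, map_pow, map_commutatorElement,
    commutatorElement_pow_right_of_commute h]

/-- An element that can always be moved one step down the upper central series, as long as its
stage is above `k`, lies in the `k`-th stage. -/
theorem mem_of_descent_upperCentralSeries [Group.IsNilpotent G] {x : G} {k : ℕ}
    (h : ∀ j ≥ k, x ∈ Subgroup.upperCentralSeries G (j + 1) → x ∈ Subgroup.upperCentralSeries G j) :
    x ∈ Subgroup.upperCentralSeries G k := by
  obtain ⟨c, hc⟩ := Group.IsNilpotent.nilpotent G
  have key : ∀ d, x ∈ Subgroup.upperCentralSeries G (k + d) →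
      x ∈ Subgroup.upperCentralSeries G k := by
    intro d
    induction d with
    | zero => exact id
    | succ d ih => exact fun hx => ih (h _ (Nat.le_add_right _ _) hx)
  refine key c (Subgroup.upperCentralSeries_mono G (Nat.le_add_left c k) ?_)
  rw [hc]; trivial

/-- The upper central quotients inherit torsion-freeness: `⁅x ^ n, g⁆` and `⁅x, g⁆ ^ n` agree one
stage below `⁅x, g⁆`, so the claim for `x` reduces to the claim for its commutators, one stage
lower. -/
theorem mem_upperCentralSeries_of_pow_mem_of_mem_succ
    (htf : ∀ (x : G) (n : ℕ), n ≠ 0 → x ^ n = 1 → x = 1) {n : ℕ} (hn : n ≠ 0) :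
    ∀ (i : ℕ) (x : G), x ∈ Subgroup.upperCentralSeries G (i + 1) →
      x ^ n ∈ Subgroup.upperCentralSeries G i → x ∈ Subgroup.upperCentralSeries G i
  | 0, x, _, h => by
    rw [Subgroup.upperCentralSeries_zero, Subgroup.mem_bot] at h ⊢
    exact htf x n hn h
  | i + 1, x, hx, h => by
    rw [Subgroup.mem_upperCentralSeries_succ_iff]
    intro g
    have hc := Subgroup.mem_upperCentralSeries_succ_iff.1 hx g
    exact mem_upperCentralSeries_of_pow_mem_of_mem_succ htf hn i _ hc
      ((commutatorElement_pow_left_mem_iff hc n).1 (Subgroup.mem_upperCentralSeries_succ_iff.1 h g))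

/-- The commutator `⁅x, g⁆` starts in the top stage and descends: modulo stage `j` its `n`-th power
is `⁅x, g ^ n⁆`, which is trivial there as long as `j ≥ k`, and the quotient has no torsion. -/
theorem commutatorElement_mem_upperCentralSeries_of_pow [Group.IsNilpotent G]
    (htf : ∀ (x : G) (n : ℕ), n ≠ 0 → x ^ n = 1 → x = 1) {n : ℕ} (hn : n ≠ 0) {k : ℕ} {x g : G}
    (h : ⁅x, g ^ n⁆ ∈ Subgroup.upperCentralSeries G k) :
    ⁅x, g⁆ ∈ Subgroup.upperCentralSeries G k :=
  mem_of_descent_upperCentralSeries fun j hj hx =>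
    mem_upperCentralSeries_of_pow_mem_of_mem_succ htf hn j _ hx
      ((commutatorElement_pow_right_mem_iff hx n).1 (Subgroup.upperCentralSeries_mono G hj h))

/-- In a torsion-free nilpotent group, the upper central series of a finite index subgroup is
induced by that of the group. -/
theorem upperCentralSeries_subgroupOf_eq [Group.IsNilpotent G]
    (htf : ∀ (x : G) (n : ℕ), n ≠ 0 → x ^ n = 1 → x = 1) (H : Subgroup G) [H.FiniteIndex] (k : ℕ) :
    (Subgroup.upperCentralSeries G k).subgroupOf H = Subgroup.upperCentralSeries H k := by
  induction k with
  | zero => simp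
  | succ k ih =>
    ext ⟨x, hx⟩
    rw [Subgroup.mem_upperCentralSeries_succ_iff, ← ih, Subgroup.mem_subgroupOf,
      Subgroup.mem_upperCentralSeries_succ_iff]
    refine ⟨fun h y => h y, fun h g => ?_⟩
    -- Finite index enters only here: a power of the arbitrary element `g` can be used as a test
    -- element in `H`.
    obtain ⟨n, hn, -, hg⟩ := Subgroup.exists_pow_mem_of_index_ne_zero
      (Subgroup.FiniteIndex.index_ne_zero (H := H)) g
    exact commutatorElement_mem_upperCentralSeries_of_pow htf (Nat.pos_iff_ne_zero.1 hn)
      (h ⟨g ^ n, hg⟩)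

theorem upperCentralSeries_isStronglyCommensuristic [Group.IsNilpotent G]
    (htf : ∀ (x : G) (n : ℕ), n ≠ 0 → x ^ n = 1 → x = 1) (k : ℕ) :
    (Subgroup.upperCentralSeries G k).IsStronglyCommensuristic := by
  intro φ
  have := φ.source_finiteIndex
  have := φ.target_finiteIndex
  rw [PartialAut.image, upperCentralSeries_subgroupOf_eq htf, PartialAut.toHom,
    ← Subgroup.map_map, ← Subgroup.comap_upperCentralSeries φ.toEquiv, inf_comm,
    ← Subgroup.subgroupOf_map_subtype, upperCentralSeries_subgroupOf_eq htf]
  congr 1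
  exact Subgroup.map_comap_eq_self_of_surjective φ.toEquiv.surjective _

end CommutatorPowers

/-! ### Lower central series of finite index subgroups -/

section FiniteIndex

variable {G : Type*} [Group G]

theorem Subgroup.FG.map_hom {M : Type*} [Group M] {P : Subgroup G} (h : P.FG) (f : G →* M) :
    (P.map f).FG := by
  obtain ⟨S, rfl, hS⟩ := (Subgroup.fg_iff _).1 h
  exact (Subgroup.fg_iff _).2 ⟨f '' S, (MonoidHom.map_closure f S).symm, hS.image f⟩

/-- If the subgroup generated by `T` is finitely generated and abelian modulo the normal subgroup
`S`, and every element of `T` has a nontrivial power in `S`, then it meets `S` in a subgroup of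
finite index. -/
theorem relIndex_ne_zero_of_closure_torsion {S : Subgroup G} [S.Normal] {T : Set G}
    (hfg : (Subgroup.closure T).FG) (hcomm : ⁅Subgroup.closure T, Subgroup.closure T⁆ ≤ S)
    (hT : ∀ x ∈ T, ∃ n ≠ 0, x ^ n ∈ S) : S.relIndex (Subgroup.closure T) ≠ 0 := by
  set P := Subgroup.closure T with hP
  set Q := P.map (QuotientGroup.mk' S) with hQ
  have hc : ∀ x ∈ P, ∀ y ∈ P, Commute (x : G ⧸ S) y := by
    intro x hx y hy
    rw [← commutatorElement_eq_one_iff_commute, ← QuotientGroup.mk'_apply,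
      ← QuotientGroup.mk'_apply, ← map_commutatorElement, QuotientGroup.mk'_apply,
      QuotientGroup.eq_one_iff]
    exact hcomm (Subgroup.commutator_mem_commutator hx hy)
  have htor : ∀ x ∈ P, ∃ n ≠ 0, (x : G ⧸ S) ^ n = 1 := by
    intro x hx
    induction hx using Subgroup.closure_induction with
    | mem x hx =>
      obtain ⟨n, hn, h⟩ := hT x hx
      exact ⟨n, hn, by rw [← QuotientGroup.mk_pow, QuotientGroup.eq_one_iff]; exact h⟩
    | one => exact ⟨1, one_ne_zero, by simp⟩
    | mul x y hx hy ihx ihy =>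
      obtain ⟨n, hn, h⟩ := ihx
      obtain ⟨m, hm, h'⟩ := ihy
      refine ⟨n * m, mul_ne_zero hn hm, ?_⟩
      rw [QuotientGroup.mk_mul, (hc x hx y hy).mul_pow, pow_mul, h, mul_comm n m, pow_mul, h']
      simp
    | inv x hx ih =>
      obtain ⟨n, hn, h⟩ := ih
      exact ⟨n, hn, by rw [QuotientGroup.mk_inv, inv_pow, h, inv_one]⟩
  let _ : CommGroup Q :=
    { (inferInstance : Group Q) with
      mul_comm := by
        rintro ⟨_, x, hx, rfl⟩ ⟨_, y, hy, rfl⟩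
        exact Subtype.ext (hc x hx y hy) }
  have : Group.FG Q := (Group.fg_iff_subgroup_fg Q).2 (hfg.map_hom _)
  have hfin : Finite Q := by
    apply CommGroup.finite_of_fg_isMulTorsion
    rintro ⟨_, x, hx, rfl⟩
    obtain ⟨n, hn, h⟩ := htor x hx
    rw [isOfFinOrder_iff_pow_eq_one]
    exact ⟨n, Nat.pos_of_ne_zero hn, Subtype.ext h⟩
  have h := Subgroup.relIndex_ker (K := P) (QuotientGroup.mk' S)
  rw [QuotientGroup.ker_mk'] at h
  rw [h]
  exact Nat.card_pos.ne'

/-- The series `B`, `⁅A, B⁆`, `⁅A, ⁅A, B⁆⁆`, … -/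
def iteratedCommutator (A B : Subgroup G) : ℕ → Subgroup G
  | 0 => B
  | n + 1 => ⁅A, iteratedCommutator A B n⁆

instance iteratedCommutator_normal (A B : Subgroup G) [A.Normal] [B.Normal] :
    ∀ n, (iteratedCommutator A B n).Normal
  | 0 => inferInstanceAs B.Normal
  | n + 1 => by
    have := iteratedCommutator_normal A B n
    exact Subgroup.commutator_normal _ _

theorem iteratedCommutator_le (A B : Subgroup G) [A.Normal] [B.Normal] :
    ∀ n, iteratedCommutator A B n ≤ B
  | 0 => le_rfl
  | n + 1 => (Subgroup.commutator_le_right _ _).trans (iteratedCommutator_le A B n)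

theorem iteratedCommutator_le_lowerCentralSeries (A B : Subgroup G) :
    ∀ n, iteratedCommutator A B n ≤ (⊤ : Subgroup G).lowerCentralSeries n
  | 0 => le_top
  | n + 1 => by
    rw [Subgroup.lowerCentralSeries_succ, Subgroup.commutator_comm]
    exact Subgroup.commutator_mono le_top (iteratedCommutator_le_lowerCentralSeries A B n)

/-- Put `B₀ = B` and `Bᵢ₊₁ = ⁅A, Bᵢ⁆`. Modulo `Bᵢ₊₂` and `⁅A', B⁆`, the group `Bᵢ₊₁` is abelian,
generated by elements `⁅a, b⁆` with `⁅a, b⁆ ^ n = ⁅a ^ n, b⁆`, which is trivial once `a ^ n ∈ A'`.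
So each layer is finite, and finiteness of the index climbs from `B_{c+1} = 1` up to `B₁ = ⁅A, B⁆`.
-/
theorem relIndex_commutator_ne_zero_left [Group.IsNilpotent G] (hfg : ∀ H : Subgroup G, H.FG)
    {A' A B : Subgroup G} [A'.Normal] [A.Normal] [B.Normal]
    (h : A'.relIndex A ≠ 0) : ⁅A', B⁆.relIndex ⁅A, B⁆ ≠ 0 := by
  obtain ⟨c, hc⟩ := Subgroup.nilpotent_iff_lowerCentralSeries.1 ‹Group.IsNilpotent G›
  have hbot : iteratedCommutator A B (c + 1) = ⊥ := by
    refine le_bot_iff.1 ((iteratedCommutator_le_lowerCentralSeries A B (c + 1)).trans ?_)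
    rw [← hc]
    exact Subgroup.lowerCentralSeries_antitone _ (Nat.le_succ c)
  have step : ∀ i, ⁅A', B⁆.relIndex (iteratedCommutator A B (i + 2)) ≠ 0 →
      ⁅A', B⁆.relIndex (iteratedCommutator A B (i + 1)) ≠ 0 := by
    intro i hi
    -- `L` is normal, as needed for a quotient, and `⁅A', B⁆` has the same relative index in it as
    -- in `Bᵢ₊₂`.
    set L := iteratedCommutator A B (i + 2) ⊔ ⁅A', B⁆ with hL
    have h1 : ⁅A', B⁆.relIndex L ≠ 0 := by rwa [hL, Subgroup.relIndex_sup_right]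
    refine Subgroup.relIndex_ne_zero_trans h1 ?_
    change L.relIndex (Subgroup.closure _) ≠ 0
    refine relIndex_ne_zero_of_closure_torsion (hfg _) ?_ ?_
    · change ⁅⁅A, iteratedCommutator A B i⁆, iteratedCommutator A B (i + 1)⁆ ≤ L
      exact (Subgroup.commutator_mono (Subgroup.commutator_le_left _ _) le_rfl).trans le_sup_left
    · rintro _ ⟨a, ha, b, hb, rfl⟩
      obtain ⟨n, hn, -, hna⟩ := Subgroup.exists_pow_mem_of_relIndex_ne_zero h ha
      refine ⟨n, hn.ne', ?_⟩
      have hcomm : Commute ⁅(a : G ⧸ L), (b : G ⧸ L)⁆ (a : G ⧸ L) := by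
        refine Commute.symm ?_
        rw [← commutatorElement_eq_one_iff_commute, ← QuotientGroup.mk'_apply,
          ← QuotientGroup.mk'_apply, ← map_commutatorElement, ← map_commutatorElement,
          QuotientGroup.mk'_apply, QuotientGroup.eq_one_iff]
        exact Subgroup.mem_sup_left (Subgroup.commutator_mem_commutator ha
          (Subgroup.commutator_mem_commutator ha hb))
      rw [← QuotientGroup.eq_one_iff, QuotientGroup.mk_pow, ← QuotientGroup.mk'_apply,
        map_commutatorElement, QuotientGroup.mk'_apply, QuotientGroup.mk'_apply,
        ← commutatorElement_pow_left_of_commute hcomm, ← QuotientGroup.mk_pow,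
        ← QuotientGroup.mk'_apply, ← QuotientGroup.mk'_apply, ← map_commutatorElement,
        QuotientGroup.mk'_apply, QuotientGroup.eq_one_iff]
      exact Subgroup.mem_sup_right
        (Subgroup.commutator_mem_commutator hna.1 (iteratedCommutator_le A B i hb))
  have key : ∀ d, ⁅A', B⁆.relIndex (iteratedCommutator A B (d + 1)) ≠ 0 →
      ⁅A', B⁆.relIndex (iteratedCommutator A B 1) ≠ 0 := by
    intro d
    induction d with
    | zero => exact id
    | succ d ih => exact fun hd => ih (step d hd)
  refine key c ?_
  rw [hbot, Subgroup.relIndex_bot_right]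
  exact one_ne_zero

theorem relIndex_commutator_ne_zero [Group.IsNilpotent G] (hfg : ∀ H : Subgroup G, H.FG)
    {A' A B' B : Subgroup G} [A'.Normal] [A.Normal] [B'.Normal] [B.Normal]
    (hA : A'.relIndex A ≠ 0) (hB : B'.relIndex B ≠ 0) :
    ⁅A', B'⁆.relIndex ⁅A, B⁆ ≠ 0 := by
  refine Subgroup.relIndex_ne_zero_trans (relIndex_commutator_ne_zero_left hfg hA) ?_
  rw [Subgroup.commutator_comm A B', Subgroup.commutator_comm A B]
  exact relIndex_commutator_ne_zero_left hfg hB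

theorem lowerCentralSeries_normal (H : Subgroup G) [H.Normal] :
    ∀ k, (H.lowerCentralSeries k).Normal
  | 0 => inferInstanceAs H.Normal
  | k + 1 => by
    have := lowerCentralSeries_normal H k
    exact Subgroup.commutator_normal _ _

/-- The commutator lemma needs normal subgroups, so the induction runs over the normal core of `H`,
whose lower central series lies inside that of `H`. -/
theorem relIndex_lowerCentralSeries_ne_zero [Group.IsNilpotent G] (hfg : ∀ H : Subgroup G, H.FG)
    (H : Subgroup G) [H.FiniteIndex] (k : ℕ) :
    (H.lowerCentralSeries k).relIndex ((⊤ : Subgroup G).lowerCentralSeries k) ≠ 0 := by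
  have hcore : (H.normalCore.lowerCentralSeries k).relIndex
      ((⊤ : Subgroup G).lowerCentralSeries k) ≠ 0 := by
    have h0 : H.normalCore.relIndex ⊤ ≠ 0 := by
      rw [Subgroup.relIndex_top_right]
      exact Subgroup.FiniteIndex.index_ne_zero
    induction k with
    | zero => exact h0
    | succ k ih =>
      have := lowerCentralSeries_normal H.normalCore k
      exact relIndex_commutator_ne_zero hfg ih h0
  exact fun h0 => hcore (Subgroup.relIndex_eq_zero_of_le_left
    (Subgroup.lowerCentralSeries_mono k H.normalCore_le) h0)

theorem commensurable_lowerCentralSeries [Group.IsNilpotent G] (hfg : ∀ H : Subgroup G, H.FG)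
    (H : Subgroup G) [H.FiniteIndex] (k : ℕ) :
    Subgroup.Commensurable (H.lowerCentralSeries k) ((⊤ : Subgroup G).lowerCentralSeries k) := by
  refine ⟨relIndex_lowerCentralSeries_ne_zero hfg H k, ?_⟩
  rw [Subgroup.relIndex_eq_one.mpr (Subgroup.lowerCentralSeries_mono k le_top)]
  exact one_ne_zero

theorem PartialAut.image_lowerCentralSeries (φ : PartialAut G) (k : ℕ) :
    φ.image (φ.source.lowerCentralSeries k) = φ.target.lowerCentralSeries k := by
  rw [PartialAut.image, ← Subgroup.top_subtype_lowerCentralSeries, Subgroup.subgroupOf,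
    Subgroup.comap_map_eq_self_of_injective φ.source.subtype_injective,
    Subgroup.map_lowerCentralSeries, PartialAut.toHom, ← Subgroup.map_map,
    Subgroup.map_top_of_surjective _ φ.toEquiv.surjective, ← MonoidHom.range_eq_map,
    Subgroup.range_subtype]

/-- Up to commensurability the series of `G` may be replaced by that of the source, which `φ`
carries exactly onto that of the target. -/
theorem lowerCentralSeries_isCommensuristic [Group.IsNilpotent G] (hfg : ∀ H : Subgroup G, H.FG)
    (k : ℕ) : ((⊤ : Subgroup G).lowerCentralSeries k).IsCommensuristic := by
  rw [Subgroup.isCommensuristic_iff]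
  intro φ
  have := φ.source_finiteIndex
  have := φ.target_finiteIndex
  have h := φ.image_commensurable (commensurable_lowerCentralSeries hfg φ.source k).symm
  rw [φ.image_lowerCentralSeries] at h
  exact h.trans (commensurable_lowerCentralSeries hfg φ.target k)

end FiniteIndex

/-! ### Finite generation of all subgroups from the abelian ones -/

section Noetherian

variable {G : Type*} [Group G]

theorem Subgroup.fg_of_map_of_inf_ker {M : Type*} [Group M] (f : G →* M) (H : Subgroup G)
    (h₁ : (H.map f).FG) (h₂ : (H ⊓ f.ker).FG) : H.FG := by
  obtain ⟨S, hS, hSfin⟩ := (Subgroup.fg_iff _).1 h₁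
  have hsub : S ⊆ f '' (H : Set G) := by
    intro s hs
    have : s ∈ H.map f := hS ▸ Subgroup.subset_closure hs
    exact this
  obtain ⟨T, hTH, hTfin, hTS⟩ := Set.exists_subset_image_finite_and
    (p := fun t => Subgroup.closure t = H.map f) |>.1 ⟨S, hsub, hSfin, hS⟩
  have : H = Subgroup.closure T ⊔ (H ⊓ f.ker) := by
    apply le_antisymm
    · intro x hx
      have hfx : f x ∈ (Subgroup.closure T).map f := by
        rw [MonoidHom.map_closure, hTS]
        exact ⟨x, hx, rfl⟩
      obtain ⟨t, ht, htx⟩ := hfx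
      have htH : t ∈ H := (Subgroup.closure_le H).2 hTH ht
      have : x = t * (t⁻¹ * x) := by group
      rw [this]
      have hker : t⁻¹ * x ∈ f.ker := by
        rw [MonoidHom.mem_ker, map_mul, map_inv, htx, inv_mul_cancel]
      exact Subgroup.mul_mem_sup ht ⟨H.mul_mem (H.inv_mem htH) hx, hker⟩
    · exact sup_le ((Subgroup.closure_le H).2 hTH) inf_le_left
  rw [this]
  exact Subgroup.FG.sup ((Subgroup.fg_iff _).2 ⟨T, rfl, hTfin⟩) h₂

theorem Subgroup.FG.of_le_of_commute {P H : Subgroup G} (hP : P.FG)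
    (hc : ∀ x ∈ P, ∀ y ∈ P, Commute x y) (hH : H ≤ P) : H.FG := by
  let _ : CommGroup P :=
    { (inferInstance : Group P) with mul_comm := fun x y => Subtype.ext (hc x x.2 y y.2) }
  have h1 : Group.FG P := (Group.fg_iff_subgroup_fg P).2 hP
  have h2 : Module.Finite ℤ (Additive P) :=
    Module.Finite.iff_addGroup_fg.2 (GroupFG.iff_add_fg.1 h1)
  have h3 : (AddSubgroup.toIntSubmodule (Subgroup.toAddSubgroup (H.subgroupOf P))).FG :=
    IsNoetherian.noetherian _
  have h4 : (H.subgroupOf P).FG := by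
    rw [Subgroup.fg_iff_add_fg]
    exact Submodule.fg_toAddSubgroup h3
  have := h4.map_hom P.subtype
  rwa [Subgroup.subgroupOf_map_subtype, inf_eq_left.2 hH] at this

/-- In a nilpotent group there is an abelian normal subgroup that contains its centralizer. -/
theorem exists_abelian_normal_centralizer_le [Group.IsNilpotent G] :
    ∃ A : Subgroup G, A.Normal ∧ (∀ x ∈ A, ∀ y ∈ A, Commute x y) ∧
      Subgroup.centralizer (A : Set G) ≤ A := by
  obtain ⟨A, hA⟩ : ∃ A : Subgroup G, Maximal (fun A : Subgroup G =>
      A.Normal ∧ ∀ x ∈ A, ∀ y ∈ A, Commute x y) A := by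
    apply zorn_le₀
    intro c hc hchain
    rcases c.eq_empty_or_nonempty with rfl | hne
    · exact ⟨⊥, ⟨inferInstance, by
        intro x hx y hy
        rw [Subgroup.mem_bot.1 hx]
        exact Commute.one_left y⟩, by simp⟩
    have hmem : ∀ {x : G}, x ∈ sSup c ↔ ∃ s ∈ c, x ∈ s :=
      Subgroup.mem_sSup_of_directedOn hne hchain.directedOn
    refine ⟨sSup c, ⟨⟨fun x hx g => ?_⟩, fun x hx y hy => ?_⟩, fun s hs => le_sSup hs⟩
    · obtain ⟨s, hs, hxs⟩ := hmem.1 hx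
      exact hmem.2 ⟨s, hs, (hc hs).1.conj_mem x hxs g⟩
    · obtain ⟨s, hs, hxs⟩ := hmem.1 hx
      obtain ⟨t, ht, hyt⟩ := hmem.1 hy
      rcases hchain.total hs ht with h | h
      · exact (hc ht).2 x (h hxs) y hyt
      · exact (hc hs).2 x hxs y (h hyt)
  have hAn : A.Normal := hA.prop.1
  refine ⟨A, hA.prop.1, hA.prop.2, ?_⟩
  -- If `x` centralizes `A` and lies in stage `i + 1`, its commutators lie in `A` by induction. Then
  -- `A` and `x` generate a normal abelian subgroup, so maximality gives `x ∈ A`.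
  have key : ∀ i, Subgroup.centralizer (A : Set G) ⊓ Subgroup.upperCentralSeries G i ≤ A := by
    intro i
    induction i with
    | zero => simp
    | succ i ih =>
      rintro x ⟨hxC, hxZ⟩
      have hcx : ∀ a ∈ A, Commute a x := fun a ha => Subgroup.mem_centralizer_iff.1 hxC a ha
      have hconj : ∀ g : G, ⁅x, g⁆ ∈ A := by
        intro g
        refine ih ⟨?_, Subgroup.mem_upperCentralSeries_succ_iff.1 hxZ g⟩
        rw [commutatorElement_def, mul_assoc, mul_assoc, ← mul_assoc g]
        exact mul_mem hxC (Subgroup.Normal.conj_mem inferInstance _ (inv_mem hxC) g)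
      have hBc : ∀ u ∈ (A : Set G) ∪ {x}, ∀ v ∈ (A : Set G) ∪ {x}, u * v = v * u := by
        rintro u (hu | rfl) v (hv | rfl)
        · exact hA.prop.2 u hu v hv
        · exact hcx u hu
        · exact (hcx v hv).symm
        · rfl
      have hB : (Subgroup.closure ((A : Set G) ∪ {x})).Normal ∧
          ∀ u ∈ Subgroup.closure ((A : Set G) ∪ {x}),
          ∀ v ∈ Subgroup.closure ((A : Set G) ∪ {x}), Commute u v := by
        constructor
        · refine ⟨fun u hu g => ?_⟩
          induction hu using Subgroup.closure_induction with
          | mem u hu =>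
            rcases hu with hu | rfl
            · exact Subgroup.subset_closure (Or.inl (hAn.conj_mem u hu g))
            · have : g * u * g⁻¹ = ⁅u, g⁆⁻¹ * u := by rw [commutatorElement_def]; group
              rw [this]
              exact mul_mem (Subgroup.subset_closure (Or.inl (inv_mem (hconj g))))
                (Subgroup.subset_closure (Or.inr rfl))
          | one => simp
          | mul u v _ _ hu hv =>
            have : g * (u * v) * g⁻¹ = (g * u * g⁻¹) * (g * v * g⁻¹) := by group
            rw [this]; exact mul_mem hu hv
          | inv u _ hu =>
            have : g * u⁻¹ * g⁻¹ = (g * u * g⁻¹)⁻¹ := by group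
            rw [this]; exact inv_mem hu
        · intro u hu v hv
          have h := Subgroup.closure_le_centralizer_centralizer ((A : Set G) ∪ {x}) hu
          refine (Subgroup.mem_centralizer_iff.1 h v ?_).symm
          have : Subgroup.closure ((A : Set G) ∪ {x}) ≤
              Subgroup.centralizer ((A : Set G) ∪ {x}) := by
            rw [Subgroup.closure_le]
            exact fun w hw => Subgroup.mem_centralizer_iff.2 fun z hz => hBc z hz w hw
          exact this hv
      exact hA.le_of_ge hB (fun a ha => Subgroup.subset_closure (Or.inl ha))
        (Subgroup.subset_closure (Or.inr rfl))
  obtain ⟨c, hc⟩ := Group.IsNilpotent.nilpotent G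
  have := key c
  rwa [hc, inf_top_eq] at this

/-- A nilpotent group whose abelian subgroups are finitely generated has only finitely generated
subgroups. -/
theorem Subgroup.fg_of_forall_abelian_fg [Group.IsNilpotent G]
    (hab : ∀ B : Subgroup G, (∀ x ∈ B, ∀ y ∈ B, Commute x y) → B.FG) (H : Subgroup G) : H.FG := by
  obtain ⟨A, hAn, hAc, hCA⟩ := exists_abelian_normal_centralizer_le (G := G)
  obtain ⟨S, hS⟩ := hab A hAc
  -- Induction on how far `H` is from centralizing `A`. For `i = 0` it does, so `H ≤ A`. In general
  -- `g ↦ (⁅g, a⁆)`, over the finitely many generators `a` of `A`, is a homomorphism modulo stage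
  -- `i`, with finitely generated abelian image and a kernel covered by the induction hypothesis.
  have key : ∀ (i : ℕ) (H : Subgroup G),
      (∀ g ∈ H, ∀ a ∈ A, ⁅g, a⁆ ∈ Subgroup.upperCentralSeries G i) → H.FG := by
    intro i
    induction i with
    | zero =>
      intro H hH
      have hHA : H ≤ A := fun g hg => hCA <| Subgroup.mem_centralizer_iff.2 fun a ha =>
        (commutatorElement_eq_one_iff_mul_comm.1 (Subgroup.mem_bot.1 (hH g hg a ha))).symm
      exact hab H fun x hx y hy => hAc x (hHA hx) y (hHA hy)
    | succ i ih =>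
      intro H hH
      have hSA : ∀ a ∈ S, a ∈ A := fun a ha => hS ▸ Subgroup.subset_closure ha
      let q := QuotientGroup.mk' (Subgroup.upperCentralSeries G i)
      let f : H →* (S → G ⧸ Subgroup.upperCentralSeries G i) :=
        { toFun := fun g a => q ⁅(g : G), (a : G)⁆
          map_one' := by ext a; simp
          map_mul' := by
            intro g h
            ext a
            have e : ⁅((g * h : H) : G), (a : G)⁆ =
                (g : G) * ⁅(h : G), (a : G)⁆ * (g : G)⁻¹ * ⁅(g : G), (a : G)⁆ := by
              simp only [commutatorElement_def, Subgroup.coe_mul]; group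
            have hc := commute_mk_of_mem_upperCentralSeries_succ (hH h h.2 a (hSA a a.2))
            change q _ = q _ * q _
            rw [e, map_mul, map_mul, map_mul, map_inv]
            have h1 : q (g : G) * q ⁅(h : G), (a : G)⁆ * (q (g : G))⁻¹ = q ⁅(h : G), (a : G)⁆ := by
              rw [mul_inv_eq_iff_eq_mul]
              exact (hc (g : G)).symm
            rw [h1]
            exact hc ⁅(g : G), (a : G)⁆ }
      let B := (A ⊓ Subgroup.upperCentralSeries G (i + 1)).map q
      have hBfg : B.FG := 
        (hab (A ⊓ _) fun x hx y hy => hAc x hx.1 y hy.1).map_hom q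
      have hBc : ∀ x ∈ B, ∀ y ∈ B, Commute x y := by
        rintro _ ⟨x, hx, rfl⟩ _ ⟨y, hy, rfl⟩
        exact (hAc x hx.1 y hy.1).map q
      rw [← Group.fg_iff_subgroup_fg, Group.fg_def]
      refine Subgroup.fg_of_map_of_inf_ker f ⊤ ?_ ?_
      · refine Subgroup.FG.of_le_of_commute (P := Subgroup.pi Set.univ fun _ => B)
          (Subgroup.FG.pi fun _ => hBfg) (fun x hx y hy => ?_) ?_
        · ext a
          exact hBc _ (hx a trivial) _ (hy a trivial)
        · rintro _ ⟨g, -, rfl⟩ a -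
          have hmem : ⁅(g : G), (a : G)⁆ ∈ A :=
            mul_mem (hAn.conj_mem _ (hSA a a.2) _) (inv_mem (hSA a a.2))
          exact ⟨_, ⟨hmem, hH g g.2 a (hSA a a.2)⟩, rfl⟩
      · rw [top_inf_eq, ← Group.fg_iff_subgroup_fg]
        have hker : (f.ker.map H.subtype).FG := by
          apply ih
          rintro _ ⟨g, hg, rfl⟩ a ha
          have hS' : ∀ s ∈ S, q ⁅(g : G), s⁆ = 1 := fun s hs =>
            congrFun (MonoidHom.mem_ker.1 hg) ⟨s, hs⟩
          rw [← hS] at ha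
          have : Commute (q g) (q a) := by
            induction ha using Subgroup.closure_induction with
            | mem s hs =>
              rw [← commutatorElement_eq_one_iff_commute, ← map_commutatorElement]
              exact hS' s hs
            | one => rw [map_one]; exact Commute.one_right _
            | mul x y _ _ hx hy => rw [map_mul]; exact hx.mul_right hy
            | inv x _ hx => rw [map_inv]; exact hx.inv_right
          rw [← commutatorElement_eq_one_iff_commute, ← map_commutatorElement] at this
          exact (QuotientGroup.eq_one_iff _).1 this
        rw [← Group.fg_iff_subgroup_fg] at hker
        exact Group.fg_of_surjective
          (f := (f.ker.equivMapOfInjective H.subtype H.subtype_injective).symm.toMonoidHom)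
          (MulEquiv.surjective _)
  obtain ⟨c, hc⟩ := Group.IsNilpotent.nilpotent G
  exact key c H fun g _ a _ => by rw [hc]; trivial

end Noetherian

/-! ### Linearization of a contraction with derivative `1/2` -/

section Linearization

open Filter Topology

variable {E : Type*} [NormedAddCommGroup E] [NormedSpace ℝ E]

set_option maxHeartbeats 1000000 in
/-- A `C²` map fixing `0` with derivative `1/2` there is conjugate to multiplication by `1/2`,
through a `C¹` change of coordinates tangent to the identity. -/
theorem exists_linearization_half [CompleteSpace E] {R : E → E} (hR : ContDiffAt ℝ 2 R 0)
    (h0 : R 0 = 0) (h' : HasFDerivAt R ((2⁻¹ : ℝ) • ContinuousLinearMap.id ℝ E) 0) :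
    ∃ l : E → E, ContDiffAt ℝ 1 l 0 ∧ l 0 = 0 ∧ HasFDerivAt l (ContinuousLinearMap.id ℝ E) 0 ∧
      ∀ᶠ x in 𝓝 0, l (R x) = (2⁻¹ : ℝ) • l x := by
  have hA1 : ContDiffAt ℝ 1 (fderiv ℝ R) 0 := hR.fderiv_right (by norm_num)
  obtain ⟨K, t, ht, hK⟩ := hA1.exists_lipschitzOnWith
  have hd : ∀ᶠ x in 𝓝 (0 : E), DifferentiableAt ℝ R x :=
    (hR.eventually (by simp)).mono fun x hx => hx.differentiableAt (by norm_num)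
  obtain ⟨r₀, hr₀, hball⟩ := Metric.eventually_nhds_iff_ball.1 (hd.and ht)
  -- This radius keeps `2 DR` within `1/8` of the identity, so `‖DR‖ ≤ 9/16 ≤ 3/4` and the iterates
  -- of `R` decay geometrically.
  obtain ⟨r, hr, hrr₀, hKr⟩ : ∃ r > 0, r ≤ r₀ ∧ 2 * K * r ≤ 1 / 8 := by
    refine ⟨min r₀ (1 / (16 * (K + 1))), by positivity, min_le_left _ _, ?_⟩
    have hK0 : (0 : ℝ) ≤ K := K.2
    calc 2 * (K : ℝ) * min r₀ (1 / (16 * (K + 1))) ≤ 2 * K * (1 / (16 * (K + 1))) := by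
          gcongr; exact min_le_right _ _
      _ ≤ 1 / 8 := by
          rw [mul_one_div, div_le_div_iff₀ (by positivity) (by norm_num)]; linarith
  set B := Metric.ball (0 : E) r with hB
  have h0B : (0 : E) ∈ B := Metric.mem_ball_self hr
  have hBt : B ⊆ t := fun x hx => (hball x (Metric.ball_subset_ball hrr₀ hx)).2
  have hRd : ∀ x ∈ B, HasFDerivAt R (fderiv ℝ R x) x := fun x hx =>
    (hball x (Metric.ball_subset_ball hrr₀ hx)).1.hasFDerivAt
  have hA0 : fderiv ℝ R 0 = (2⁻¹ : ℝ) • ContinuousLinearMap.id ℝ E := h'.fderiv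
  have hAd : ∀ x ∈ B, ‖(2 : ℝ) • fderiv ℝ R x - ContinuousLinearMap.id ℝ E‖ ≤ 2 * K * ‖x‖ := by
    intro x hx
    have h1 := hK.norm_sub_le (hBt hx) (hBt h0B)
    rw [hA0, sub_zero] at h1
    have h2 : (2 : ℝ) • fderiv ℝ R x - ContinuousLinearMap.id ℝ E =
        (2 : ℝ) • (fderiv ℝ R x - (2⁻¹ : ℝ) • ContinuousLinearMap.id ℝ E) := by
      rw [smul_sub, smul_smul]; norm_num
    rw [h2, norm_smul, Real.norm_ofNat, mul_assoc]
    gcongr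
  have hRc : ∀ x ∈ B, ‖R x‖ ≤ 3 / 4 * ‖x‖ := by
    intro x hx
    have hb : ∀ y ∈ B, ‖fderiv ℝ R y‖ ≤ 3 / 4 := by
      intro y hy
      have h1 : fderiv ℝ R y = (2⁻¹ : ℝ) • (((2 : ℝ) • fderiv ℝ R y - ContinuousLinearMap.id ℝ E)
          + ContinuousLinearMap.id ℝ E) := by
        rw [sub_add_cancel, smul_smul]; norm_num
      have hy' : ‖y‖ < r := by simpa [hB] using hy
      have h2 : 2 * (K : ℝ) * ‖y‖ ≤ 1 / 8 := le_trans (by gcongr) hKr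
      rw [h1, norm_smul]
      calc ‖(2⁻¹ : ℝ)‖ * _ ≤ 2⁻¹ * (1 / 8 + 1) := by
            rw [Real.norm_of_nonneg (by norm_num)]
            gcongr
            exact (norm_add_le _ _).trans (add_le_add ((hAd y hy).trans h2)
              ContinuousLinearMap.norm_id_le)
        _ ≤ 3 / 4 := by norm_num
    have := (convex_ball (0 : E) r).norm_image_sub_le_of_norm_hasFDerivWithin_le
      (fun y hy => (hRd y hy).hasFDerivWithinAt) hb h0B hx
    simpa [h0] using this
  have hRB : ∀ x ∈ B, R x ∈ B := by
    intro x hx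
    have hx' : ‖x‖ < r := by simpa [hB] using hx
    have := hRc x hx
    simp only [hB, mem_ball_zero_iff]
    nlinarith [norm_nonneg x]
  have hit : ∀ n, ∀ x ∈ B, R^[n] x ∈ B ∧ ‖R^[n] x‖ ≤ (3 / 4) ^ n * r := by
    intro n x hx
    induction n with
    | zero => exact ⟨hx, by simpa using (mem_ball_zero_iff.1 hx).le⟩
    | succ n ih =>
      rw [Function.iterate_succ', Function.comp_apply]
      refine ⟨hRB _ ih.1, (hRc _ ih.1).trans ?_⟩
      rw [pow_succ']
      linarith [ih.2]
  obtain ⟨D, hD0, hDs⟩ : ∃ D : ℕ → E → E →L[ℝ] E, (∀ x, D 0 x = ContinuousLinearMap.id ℝ E) ∧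
      ∀ n x, D (n + 1) x = (fderiv ℝ R (R^[n] x)).comp (D n x) :=
    ⟨fun n x => Nat.rec (ContinuousLinearMap.id ℝ E)
      (fun n P => (fderiv ℝ R (R^[n] x)).comp P) n, fun _ => rfl, fun _ _ => rfl⟩
  have hDd : ∀ n, ∀ x ∈ B, HasFDerivAt (R^[n]) (D n x) x := by
    intro n x hx
    induction n with
    | zero => rw [hD0]; exact hasFDerivAt_id x
    | succ n ih =>
      rw [Function.iterate_succ', hDs]
      exact (hRd _ (hit n x hx).1).comp x ih
  -- The coordinate is `l = lim 2 ^ n • R^[n]`, written as a telescoping series. The Lipschitz bound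
  -- on `DR` makes the differentiated series converge as well, so `l` is `C¹`.
  let f : ℕ → E → E := fun n x => (2 : ℝ) ^ (n + 1) • R^[n + 1] x - (2 : ℝ) ^ n • R^[n] x
  let f' : ℕ → E → E →L[ℝ] E := fun n x => (2 : ℝ) ^ (n + 1) • D (n + 1) x - (2 : ℝ) ^ n • D n x
  have hff' : ∀ n, ∀ x ∈ B, HasFDerivAt (f n) (f' n x) x := fun n x hx =>
    ((hDd (n + 1) x hx).const_smul _).sub ((hDd n x hx).const_smul _)
  have hf'c : ∀ n x, f' n x = ((2 : ℝ) • fderiv ℝ R (R^[n] x) - ContinuousLinearMap.id ℝ E).comp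
      ((2 : ℝ) ^ n • D n x) := by
    intro n x
    simp only [f', hDs]
    ext v
    simp [pow_succ, mul_smul, smul_sub]
  have hstep : ∀ n, ∀ x ∈ B, ‖f' n x‖ ≤ 1 / 8 * (3 / 4) ^ n * ‖(2 : ℝ) ^ n • D n x‖ := by
    intro n x hx
    rw [hf'c]
    refine (ContinuousLinearMap.opNorm_comp_le _ _).trans ?_
    gcongr
    refine (hAd _ (hit n x hx).1).trans ?_
    calc 2 * (K : ℝ) * ‖R^[n] x‖ ≤ 2 * K * ((3 / 4) ^ n * r) := by gcongr; exact (hit n x hx).2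
      _ = (2 * K * r) * (3 / 4) ^ n := by ring
      _ ≤ _ := by gcongr
  -- The bound is shaped to close the induction: a step adds at most `1/8 * (3/4) ^ n * 2`, which is
  -- exactly its increment.
  have hDb : ∀ n, ∀ x ∈ B, ‖(2 : ℝ) ^ n • D n x‖ ≤ 2 - (3 / 4) ^ n := by
    intro n x hx
    induction n with
    | zero =>
      simp only [pow_zero, one_smul, hD0]
      exact ContinuousLinearMap.norm_id_le.trans (by norm_num)
    | succ n ih =>
      have h1 : (2 : ℝ) ^ (n + 1) • D (n + 1) x = f' n x + (2 : ℝ) ^ n • D n x := by simp [f']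
      rw [h1]
      have h2 := hstep n x hx
      have h3 : (0 : ℝ) < (3 / 4) ^ n := by positivity
      refine (norm_add_le _ _).trans ?_
      rw [pow_succ]
      nlinarith
  have hbound : ∀ n, ∀ x ∈ B, ‖f' n x‖ ≤ 1 / 4 * (3 / 4) ^ n := by
    intro n x hx
    have h3 : (0 : ℝ) < (3 / 4) ^ n := by positivity
    have h2 := hstep n x hx
    have h1 := hDb n x hx
    nlinarith
  have hsum : Summable fun n : ℕ => (1 / 4 : ℝ) * (3 / 4) ^ n :=
    (summable_geometric_of_lt_one (by norm_num) (by norm_num)).mul_left _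
  have hit0 : ∀ n, R^[n] 0 = 0 := fun n => Function.iterate_fixed h0 n
  have hf0 : ∀ n, f n 0 = 0 := by intro n; simp only [f, hit0, smul_zero, sub_zero]
  have hs0 : Summable fun n => f n 0 := by simp only [hf0]; exact summable_zero
  have hpre : IsPreconnected B := (convex_ball (0 : E) r).isPreconnected
  have hopen : IsOpen B := Metric.isOpen_ball
  have hfs : ∀ x ∈ B, Summable fun n => f n x := fun x hx =>
    summable_of_summable_hasFDerivAt_of_isPreconnected hsum hopen hpre hff' hbound h0B hs0 hx
  have hder : ∀ x ∈ B, HasFDerivAt (fun x => x + ∑' n, f n x)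
      (ContinuousLinearMap.id ℝ E + ∑' n, f' n x) x := fun x hx =>
    (hasFDerivAt_id x).add
      (hasFDerivAt_tsum_of_isPreconnected hsum hopen hpre hff' hbound h0B hs0 hx)
  have hDcont : ∀ n, ContinuousOn (D n) B := by
    intro n
    induction n with
    | zero => exact continuousOn_const.congr fun x _ => hD0 x
    | succ n ih =>
      have h1 : ContinuousOn (R^[n]) B := fun x hx => (hDd n x hx).continuousAt.continuousWithinAt
      have h2 : ContinuousOn (fun x => fderiv ℝ R (R^[n] x)) B :=
        (hK.continuousOn.mono hBt).comp h1 fun x hx => (hit n x hx).1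
      exact (h2.clm_comp ih).congr fun x _ => hDs n x
  refine ⟨fun x => x + ∑' n, f n x, ?_, ?_, ?_, ?_⟩
  · rw [contDiffAt_one_iff]
    refine ⟨fun x => ContinuousLinearMap.id ℝ E + ∑' n, f' n x, B, hopen.mem_nhds h0B, ?_, hder⟩
    refine continuousOn_const.add (continuousOn_tsum (fun n => ?_) hsum fun n x hx => hbound n x hx)
    exact ((hDcont (n + 1)).const_smul ((2 : ℝ) ^ (n + 1))).sub ((hDcont n).const_smul ((2 : ℝ) ^ n))
  · simp [hf0]
  · have h1 : ∀ n, f' n 0 = 0 := by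
      intro n
      rw [hf'c, hit0, hA0, smul_smul]
      norm_num
    have := hder 0 h0B
    simp only [h1, tsum_zero, add_zero] at this
    exact this
  · filter_upwards [hopen.mem_nhds h0B] with x hx
    have h1 : ∀ n, f n (R x) = (2⁻¹ : ℝ) • f (n + 1) x := by
      intro n
      simp only [f, smul_sub, smul_smul, ← Function.iterate_succ_apply]
      congr 2 <;> ring
    simp only [h1]
    rw [tsum_const_smul'', (hfs x hx).tsum_eq_zero_add]
    have h2 : f 0 x = (2 : ℝ) • R x - x := by simp [f]
    rw [h2]
    module

end Linearization

/-! ### Coordinates in which squaring is multiplication by `2` -/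

section CanonicalCoordinates

open Filter Topology

variable {E : Type*} [NormedAddCommGroup E] [NormedSpace ℝ E]

theorem hasFDerivAt_add_of_unit {m : E × E → E} (hm : DifferentiableAt ℝ m 0)
    (hl : ∀ᶠ x in 𝓝 (0 : E), m (x, 0) = x) (hr : ∀ᶠ x in 𝓝 (0 : E), m (0, x) = x) :
    HasFDerivAt m (ContinuousLinearMap.fst ℝ E E + ContinuousLinearMap.snd ℝ E E) 0 := by
  have h := hm.hasFDerivAt
  have h1 : (fderiv ℝ m 0).comp (ContinuousLinearMap.inl ℝ E E) = ContinuousLinearMap.id ℝ E := by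
    have h2 : HasFDerivAt (fun x : E => m (x, 0))
        ((fderiv ℝ m 0).comp (ContinuousLinearMap.inl ℝ E E)) 0 :=
      HasFDerivAt.comp (g := m) (0 : E) h (ContinuousLinearMap.inl ℝ E E).hasFDerivAt
    exact h2.unique ((hasFDerivAt_id (𝕜 := ℝ) (0 : E)).congr_of_eventuallyEq hl)
  have h3 : (fderiv ℝ m 0).comp (ContinuousLinearMap.inr ℝ E E) = ContinuousLinearMap.id ℝ E := by
    have h2 : HasFDerivAt (fun x : E => m (0, x))
        ((fderiv ℝ m 0).comp (ContinuousLinearMap.inr ℝ E E)) 0 :=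
      HasFDerivAt.comp (g := m) (0 : E) h (ContinuousLinearMap.inr ℝ E E).hasFDerivAt
    exact h2.unique ((hasFDerivAt_id (𝕜 := ℝ) (0 : E)).congr_of_eventuallyEq hr)
  have h4 : fderiv ℝ m 0 = ContinuousLinearMap.fst ℝ E E + ContinuousLinearMap.snd ℝ E E := by
    apply ContinuousLinearMap.prod_ext
    · rw [h1]; ext; simp
    · rw [h3]; ext; simp
  rwa [h4] at h

/-- The linearization is applied to the local inverse of `s`, which contracts; evaluating `l (R y) =
l y / 2` at `y = s x` gives the doubling law for `s`. -/
theorem exists_doubling_coordinates [CompleteSpace E] {s : E → E} (hs : ContDiffAt ℝ 2 s 0)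
    (h0 : s 0 = 0) (hs' : HasFDerivAt s ((2 : ℝ) • ContinuousLinearMap.id ℝ E) 0) :
    ∃ Φ : OpenPartialHomeomorph E E, 0 ∈ Φ.source ∧ Φ 0 = 0 ∧ ContDiffAt ℝ 1 Φ 0 ∧
      ContDiffAt ℝ 1 Φ.symm 0 ∧ ∀ᶠ x in 𝓝 0, Φ (s x) = (2 : ℝ) • Φ x := by
  let u : E ≃L[ℝ] E := ContinuousLinearEquiv.smulLeft (Units.mk0 (2 : ℝ) two_ne_zero)
  have hu : HasFDerivAt s (u : E →L[ℝ] E) 0 := hs'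
  have hsstrict := hs.hasStrictFDerivAt' hu two_ne_zero
  have hR := hs.to_localInverse hu two_ne_zero
  have hR0 := hs.localInverse_apply_image hu two_ne_zero
  have hR' := hsstrict.to_localInverse.hasFDerivAt
  have hleft := hsstrict.eventually_left_inverse
  rw [h0] at hR hR0 hR'
  obtain ⟨l, hl, hl0, hl', hlR⟩ := exists_linearization_half hR hR0
    (hR'.congr_fderiv (by ext x; rfl))
  have hle : HasFDerivAt l ((ContinuousLinearEquiv.refl ℝ E : E ≃L[ℝ] E) : E →L[ℝ] E) 0 := hl'
  have hmem := hl.mem_toOpenPartialHomeomorph_source hle one_ne_zero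
  refine ⟨hl.toOpenPartialHomeomorph l hle one_ne_zero, hmem, hl0, hl, ?_, ?_⟩
  · have := hl.to_localInverse hle one_ne_zero
    rwa [hl0] at this
  · have hs0 : Tendsto s (𝓝 0) (𝓝 0) := by
      have := hs.continuousAt.tendsto
      rwa [h0] at this
    filter_upwards [hs0.eventually hlR, hleft] with x hx1 hx2
    change l (s x) = (2 : ℝ) • l x
    have hx3 : hs.localInverse hu two_ne_zero (s x) = x := hx2
    rw [hx3] at hx1
    rw [hx1, smul_smul]
    norm_num

variable (N : Type*) [Group N] [TopologicalSpace N] (E)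

/-- Canonical coordinates of the first kind near the identity of a topological group: a chart in
which multiplication is `C¹`, inversion and conjugations are differentiable at the origin, and
squaring is multiplication by `2`. -/
structure CanonicalCoordinates where
  chart : OpenPartialHomeomorph N E
  one_mem : 1 ∈ chart.source
  map_one : chart 1 = 0
  contDiffAt_mul : ContDiffAt ℝ 1 (fun p : E × E => chart (chart.symm p.1 * chart.symm p.2)) 0
  differentiableAt_conj : ∀ g : N, DifferentiableAt ℝ (fun x => chart (g * chart.symm x * g⁻¹)) 0
  differentiableAt_inv : DifferentiableAt ℝ (fun x => chart (chart.symm x)⁻¹) 0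
  map_sq : ∀ᶠ g in 𝓝 (1 : N), chart (g * g) = (2 : ℝ) • chart g

variable {E N}

/-- A chart of a topological group at the identity in which the group operations are `C²` can be
improved to canonical coordinates. -/
theorem exists_canonicalCoordinates_of_chart [CompleteSpace E]
    (κ : OpenPartialHomeomorph N E)
    (h1 : 1 ∈ κ.source) (hκ1 : κ 1 = 0)
    (hmul : ContDiffAt ℝ 2 (fun p : E × E => κ (κ.symm p.1 * κ.symm p.2)) 0)
    (hconj : ∀ g : N, ContDiffAt ℝ 2 (fun x => κ (g * κ.symm x * g⁻¹)) 0)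
    (hinv : ContDiffAt ℝ 2 (fun x => κ (κ.symm x)⁻¹) 0) : Nonempty (CanonicalCoordinates E N) := by
  have hκs0 : κ.symm 0 = 1 := by rw [← hκ1, κ.left_inv h1]
  have h0t : (0 : E) ∈ κ.target := by rw [← hκ1]; exact κ.map_source h1
  have hκr : ∀ᶠ x in 𝓝 (0 : E), κ (κ.symm x) = x := κ.eventually_right_inverse h0t
  have hκl : ∀ᶠ x in 𝓝 (1 : N), κ.symm (κ x) = x := κ.eventually_left_inverse h1
  have hm' := hasFDerivAt_add_of_unit (hmul.differentiableAt two_ne_zero)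
    (by filter_upwards [hκr] with x hx; simpa [hκs0] using hx)
    (by filter_upwards [hκr] with x hx; simpa [hκs0] using hx)
  let δ : E →L[ℝ] E × E := (ContinuousLinearMap.id ℝ E).prod (ContinuousLinearMap.id ℝ E)
  let s : E → E := fun x => κ (κ.symm x * κ.symm x)
  have hs : ContDiffAt ℝ 2 s 0 :=
    ContDiffAt.comp (g := fun p : E × E => κ (κ.symm p.1 * κ.symm p.2)) (f := δ) (0 : E) hmul
      δ.contDiff.contDiffAt
  have hs0 : s 0 = 0 := by simp [s, hκs0, hκ1]
  have hs' : HasFDerivAt s ((2 : ℝ) • ContinuousLinearMap.id ℝ E) 0 := by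
    have := HasFDerivAt.comp (g := fun p : E × E => κ (κ.symm p.1 * κ.symm p.2)) (f := δ) (0 : E)
      hm' δ.hasFDerivAt
    exact this.congr_fderiv (by ext x; simp [δ, two_smul])
  -- One derivative is lost here: `Φ` is only `C¹`, hence so are the group operations in the new
  -- chart.
  obtain ⟨Φ, hΦ0, hΦ00, hΦ, hΦs, hΦ2⟩ := exists_doubling_coordinates hs hs0 hs'
  have hΦs0 : Φ.symm 0 = 0 := by conv_lhs => rw [← hΦ00, Φ.left_inv hΦ0]
  have hmem : (1 : N) ∈ (κ.trans Φ).source := by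
    rw [OpenPartialHomeomorph.trans_source]
    exact ⟨h1, by rw [Set.mem_preimage, hκ1]; exact hΦ0⟩
  have key : ∀ f : N → N, f 1 = 1 → ContDiffAt ℝ 2 (fun x => κ (f (κ.symm x))) 0 →
      ContDiffAt ℝ 1 (fun x => (κ.trans Φ) (f ((κ.trans Φ).symm x))) 0 := by
    intro f hf hc
    have h2 : ContDiffAt ℝ 1 (fun x => κ (f (κ.symm (Φ.symm x)))) 0 := by
      refine ContDiffAt.comp (g := fun x => κ (f (κ.symm x))) (0 : E) ?_ hΦs
      rw [hΦs0]; exact hc.of_le (by norm_num)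
    change ContDiffAt ℝ 1 (fun x => Φ (κ (f (κ.symm (Φ.symm x))))) 0
    refine ContDiffAt.comp (g := Φ) (0 : E) ?_ h2
    rw [hΦs0, hκs0, hf, hκ1]; exact hΦ
  refine ⟨⟨κ.trans Φ, hmem, by simp [hκ1, hΦ00], ?_, fun g => ?_, ?_, ?_⟩⟩
  · have h2 : ContDiffAt ℝ 1 (fun p : E × E =>
        κ (κ.symm (Φ.symm p.1) * κ.symm (Φ.symm p.2))) 0 := by
      refine ContDiffAt.comp (g := fun p : E × E => κ (κ.symm p.1 * κ.symm p.2))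
        (f := fun p : E × E => (Φ.symm p.1, Φ.symm p.2)) (0 : E × E) ?_ ?_
      · simp only [Prod.fst_zero, Prod.snd_zero, hΦs0]
        exact hmul.of_le (by norm_num)
      · exact (ContDiffAt.comp (g := Φ.symm) (0 : E × E) hΦs contDiffAt_fst).prodMk
          (ContDiffAt.comp (g := Φ.symm) (0 : E × E) hΦs contDiffAt_snd)
    refine ContDiffAt.comp (g := Φ) (0 : E × E) ?_ h2
    simpa [hΦs0, hκs0, hκ1] using hΦ
  · exact (key (fun x => g * x * g⁻¹) (by simp) (hconj g)).differentiableAt one_ne_zero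
  · exact (key (fun x => x⁻¹) (by simp) hinv).differentiableAt one_ne_zero
  · have hκt : Tendsto κ (𝓝 1) (𝓝 0) := by
      have := (κ.continuousAt h1).tendsto
      rwa [hκ1] at this
    filter_upwards [hκt.eventually hΦ2, hκl] with g hg1 hg2
    simpa [s, hg2] using hg1

theorem exists_canonicalCoordinates [CompleteSpace E] [ChartedSpace E N]
    [LieGroup 𝓘(ℝ, E) ∞ N] : Nonempty (CanonicalCoordinates E N) := by
  have : IsManifold 𝓘(ℝ, E) ∞ N := inferInstance
  let c := chartAt E (1 : N)
  let v := c 1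
  let κ : OpenPartialHomeomorph N E :=
    c.trans (Homeomorph.addRight (-v)).toOpenPartialHomeomorph
  have hκ : ∀ x, κ x = c x - v := fun x => by simp [κ, sub_eq_add_neg]
  have hκs : ∀ x, κ.symm x = c.symm (x + v) := fun x => by
    change c.symm (x + - -v) = _
    rw [neg_neg]
  have h1c : (1 : N) ∈ c.source := mem_chart_source E 1
  have hcs : ContMDiffAt 𝓘(ℝ, E) 𝓘(ℝ, E) ∞ c 1 :=
    (contMDiffOn_chart (I := 𝓘(ℝ, E)) (n := ∞)).contMDiffAt (c.open_source.mem_nhds h1c)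
  have hcs' : ContMDiffAt 𝓘(ℝ, E) 𝓘(ℝ, E) ∞ c.symm v :=
    (contMDiffOn_chart_symm (I := 𝓘(ℝ, E)) (n := ∞)).contMDiffAt
      (c.open_target.mem_nhds (c.map_source h1c))
  have hκ1 : κ 1 = 0 := by rw [hκ, sub_self]
  have hκs0 : κ.symm 0 = 1 := by rw [hκs, zero_add]; exact c.left_inv h1c
  have hκm : ContMDiffAt 𝓘(ℝ, E) 𝓘(ℝ, E) ∞ κ 1 := by
    have : (κ : N → E) = (fun y => y - v) ∘ c := funext hκ
    rw [this]
    exact (contDiff_id.sub contDiff_const).contMDiff.contMDiffAt.comp 1 hcs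
  have hκsm : ContMDiffAt 𝓘(ℝ, E) 𝓘(ℝ, E) ∞ κ.symm 0 := by
    have : (κ.symm : E → N) = c.symm ∘ (fun y => y + v) := funext hκs
    rw [this]
    refine ContMDiffAt.comp (0 : E) ?_ (contDiff_id.add contDiff_const).contMDiff.contMDiffAt
    simpa using hcs'
  refine exists_canonicalCoordinates_of_chart κ (by simp [κ, h1c]) hκ1 ?_ (fun g => ?_) ?_
  · refine ContDiffAt.of_le (n := ∞) ?_ (WithTop.coe_le_coe.2 (le_top : (2 : ℕ∞) ≤ ⊤))
    rw [← contMDiffAt_iff_contDiffAt]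
    have hf : ContMDiffAt 𝓘(ℝ, E × E) 𝓘(ℝ, E) ∞ (fun p : E × E => κ.symm p.1) 0 :=
      ContMDiffAt.comp (g := κ.symm) (0 : E × E) hκsm contDiff_fst.contMDiff.contMDiffAt
    have hg : ContMDiffAt 𝓘(ℝ, E × E) 𝓘(ℝ, E) ∞ (fun p : E × E => κ.symm p.2) 0 :=
      ContMDiffAt.comp (g := κ.symm) (0 : E × E) hκsm contDiff_snd.contMDiff.contMDiffAt
    refine ContMDiffAt.comp (g := κ) (0 : E × E) ?_ (hf.mul hg)
    simpa [hκs0] using hκm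
  · refine ContDiffAt.of_le (n := ∞) ?_ (WithTop.coe_le_coe.2 (le_top : (2 : ℕ∞) ≤ ⊤))
    rw [← contMDiffAt_iff_contDiffAt]
    refine ContMDiffAt.comp (g := κ) (0 : E) ?_
      ((contMDiffAt_const.mul hκsm).mul contMDiffAt_const)
    simpa [hκs0] using hκm
  · refine ContDiffAt.of_le (n := ∞) ?_ (WithTop.coe_le_coe.2 (le_top : (2 : ℕ∞) ≤ ⊤))
    rw [← contMDiffAt_iff_contDiffAt]
    refine ContMDiffAt.comp (g := κ) (0 : E) ?_ hκsm.inv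
    simpa [hκs0] using hκm

end CanonicalCoordinates

/-! ### Rigidity of maps that commute with doubling -/

section Doubling

open Filter Topology

variable {E F : Type*} [NormedAddCommGroup E] [NormedSpace ℝ E] [NormedAddCommGroup F]
  [NormedSpace ℝ F]

theorem tendsto_two_pow_inv_smul (x : F) :
    Tendsto (fun n : ℕ => ((2 : ℝ) ^ n)⁻¹ • x) atTop (𝓝 0) := by
  have h : Tendsto (fun n : ℕ => ((2 : ℝ) ^ n)⁻¹) atTop (𝓝 0) :=
    tendsto_inv_atTop_zero.comp (tendsto_pow_atTop_atTop_of_one_lt one_lt_two)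
  simpa using h.smul_const x

theorem two_smul_two_pow_succ_inv_smul (n : ℕ) (x : F) :
    (2 : ℝ) • ((2 : ℝ) ^ (n + 1))⁻¹ • x = ((2 : ℝ) ^ n)⁻¹ • x := by
  rw [smul_smul]
  congr 1
  rw [pow_succ]
  field_simp

/-- A map that is differentiable at `0` and commutes with doubling near `0` is linear near `0`. -/
theorem eventually_eq_of_doubling {f : F → E} {L : F →L[ℝ] E} (hf : HasFDerivAt f L 0)
    (h2 : ∀ᶠ x in 𝓝 0, f ((2 : ℝ) • x) = (2 : ℝ) • f x) : ∀ᶠ x in 𝓝 0, f x = L x := by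
  have hf0 : f 0 = 0 := by
    have := h2.self_of_nhds
    rw [smul_zero, two_smul] at this
    simpa using this
  obtain ⟨δ, hδ, hb⟩ := Metric.eventually_nhds_iff_ball.1 h2
  filter_upwards [Metric.ball_mem_nhds (0 : F) hδ] with x hx
  -- The right side is a rescaled difference quotient at `0`, so it tends to `L x`.
  have hn : ∀ n : ℕ, f x = (2 : ℝ) ^ n • f (((2 : ℝ) ^ n)⁻¹ • x) := by
    intro n
    induction n with
    | zero => simp
    | succ n ih =>
      have hmem : ((2 : ℝ) ^ (n + 1))⁻¹ • x ∈ Metric.ball (0 : F) δ := by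
        rw [mem_ball_zero_iff] at hx ⊢
        rw [norm_smul, norm_inv, norm_pow, Real.norm_ofNat]
        refine lt_of_le_of_lt (mul_le_of_le_one_left (norm_nonneg x) ?_) hx
        exact inv_le_one_of_one_le₀ (one_le_pow₀ one_le_two)
      have := hb _ hmem
      rw [two_smul_two_pow_succ_inv_smul] at this
      rw [ih, this, smul_smul, pow_succ]
  have hlim := hf.lim (l := atTop) (c := fun n : ℕ => (2 : ℝ) ^ n) x
    (by simpa using tendsto_pow_atTop_atTop_of_one_lt (one_lt_two (α := ℝ)))
  simp only [zero_add, hf0, sub_zero, ← hn] at hlim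
  exact tendsto_nhds_unique tendsto_const_nhds hlim

theorem eq_two_pow_of_doubling {M : Type*} [Monoid M] {u : F → M}
    (hu : ∀ x, u ((2 : ℝ) • x) = u x * u x) (n : ℕ) (x : F) :
    u x = u (((2 : ℝ) ^ n)⁻¹ • x) ^ 2 ^ n := by
  induction n with
  | zero => simp
  | succ n ih =>
    rw [ih, ← two_smul_two_pow_succ_inv_smul, hu, ← pow_two, ← pow_mul, ← pow_succ']

theorem eq_of_doubling_of_eventuallyEq {M : Type*} [Monoid M] {u v : F → M}
    (hu : ∀ x, u ((2 : ℝ) • x) = u x * u x) (hv : ∀ x, v ((2 : ℝ) • x) = v x * v x)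
    (h : ∀ᶠ x in 𝓝 0, u x = v x) (x : F) : u x = v x := by
  obtain ⟨n, hn⟩ := ((tendsto_two_pow_inv_smul x).eventually h).exists
  rw [eq_two_pow_of_doubling hu n, eq_two_pow_of_doubling hv n, hn]

end Doubling

/-! ### The exponential map and the adjoint representation -/

namespace CanonicalCoordinates

set_option linter.unusedSectionVars false

open Filter Topology

variable {E N : Type*} [NormedAddCommGroup E] [NormedSpace ℝ E] [Group N] [TopologicalSpace N]
  [IsTopologicalGroup N] (K : CanonicalCoordinates E N)

theorem symm_zero : K.chart.symm 0 = 1 := by rw [← K.map_one, K.chart.left_inv K.one_mem]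

theorem zero_mem : (0 : E) ∈ K.chart.target := by
  rw [← K.map_one]; exact K.chart.map_source K.one_mem

theorem tendsto_chart : Tendsto K.chart (𝓝 1) (𝓝 0) := by
  have := (K.chart.continuousAt K.one_mem).tendsto
  rwa [K.map_one] at this

theorem tendsto_symm : Tendsto K.chart.symm (𝓝 0) (𝓝 1) := by
  have := (K.chart.continuousAt_symm K.zero_mem).tendsto
  rwa [K.symm_zero] at this

theorem eventually_chart_symm : ∀ᶠ x in 𝓝 (0 : E), K.chart (K.chart.symm x) = x :=
  K.chart.eventually_right_inverse K.zero_mem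

theorem eventually_symm_chart : ∀ᶠ g in 𝓝 (1 : N), K.chart.symm (K.chart g) = g :=
  K.chart.eventually_left_inverse K.one_mem

theorem tendsto_mul_one_one {α : Type*} {l : Filter α} {u v : α → N} (hu : Tendsto u l (𝓝 1))
    (hv : Tendsto v l (𝓝 1)) : Tendsto (fun x => u x * v x) l (𝓝 1) := by
  simpa using hu.mul hv

theorem eventually_symm_two_smul :
    ∀ᶠ x in 𝓝 (0 : E), K.chart.symm ((2 : ℝ) • x) = K.chart.symm x * K.chart.symm x := by
  have h := tendsto_mul_one_one K.tendsto_symm K.tendsto_symm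
  filter_upwards [K.tendsto_symm.eventually K.map_sq, K.eventually_chart_symm,
    h.eventually K.eventually_symm_chart] with x h1 h2 h3
  rw [← h3, h1, h2]

/-- Take the inverse chart at `2 ^ (-n) • x`, raised to the power `2 ^ n`; by the squaring law this
does not depend on `n` once the scaled point is in a small ball. -/
theorem exists_exp : ∃ f : E → N, (∀ x, f ((2 : ℝ) • x) = f x * f x) ∧
    ∀ᶠ x in 𝓝 0, f x = K.chart.symm x := by
  obtain ⟨δ, hδ, hb⟩ := Metric.eventually_nhds_iff_ball.1 K.eventually_symm_two_smul
  let P : E → ℕ → N := fun x n => K.chart.symm (((2 : ℝ) ^ n)⁻¹ • x) ^ 2 ^ n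
  have hP : ∀ x n, ((2 : ℝ) ^ (n + 1))⁻¹ • x ∈ Metric.ball (0 : E) δ → P x (n + 1) = P x n := by
    intro x n hx
    simp only [P]
    rw [← two_smul_two_pow_succ_inv_smul n, hb _ hx, ← pow_two, ← pow_mul, ← pow_succ']
  have hmono : ∀ (x : E) (m n : ℕ), m ≤ n → ((2 : ℝ) ^ m)⁻¹ • x ∈ Metric.ball (0 : E) δ →
      ((2 : ℝ) ^ n)⁻¹ • x ∈ Metric.ball (0 : E) δ := by
    intro x m n hmn hx
    rw [mem_ball_zero_iff, norm_smul, norm_inv, norm_pow, Real.norm_ofNat] at hx ⊢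
    refine lt_of_le_of_lt ?_ hx
    gcongr
    exact one_le_two
  have hstab : ∀ (x : E) (m n : ℕ), m ≤ n → ((2 : ℝ) ^ m)⁻¹ • x ∈ Metric.ball (0 : E) δ →
      P x n = P x m := by
    intro x m n hmn hx
    induction n, hmn using Nat.le_induction with
    | base => rfl
    | succ n hmn ih => rw [hP x n (hmono x m (n + 1) (hmn.trans n.le_succ) hx), ih]
  have hex : ∀ x : E, ∃ n : ℕ, ((2 : ℝ) ^ n)⁻¹ • x ∈ Metric.ball (0 : E) δ := fun x =>
    ((tendsto_two_pow_inv_smul x).eventually (Metric.ball_mem_nhds (0 : E) hδ)).exists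
  choose ν hν using hex
  refine ⟨fun x => P x (ν x), fun x => ?_, ?_⟩
  · change P ((2 : ℝ) • x) (ν ((2 : ℝ) • x)) = P x (ν x) * P x (ν x)
    -- The index for `2 • x` is one more than that for `x`, so that both powers have the same base
    -- point.
    have h1 := hstab ((2 : ℝ) • x) _ (max (ν ((2 : ℝ) • x)) (ν x) + 1)
      ((le_max_left _ _).trans (Nat.le_succ _)) (hν _)
    have h2 := hstab x _ (max (ν ((2 : ℝ) • x)) (ν x)) (le_max_right _ _) (hν _)
    rw [← h1, ← h2]
    simp only [P]
    rw [smul_comm, two_smul_two_pow_succ_inv_smul, pow_succ 2, pow_mul, pow_two]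
  · filter_upwards [Metric.ball_mem_nhds (0 : E) hδ] with x hx
    have := hstab x 0 (ν x) (Nat.zero_le _) (by simpa using hx)
    simpa [P] using this

/-- The exponential map of a topological group with canonical coordinates. -/
noncomputable def exp : E → N := K.exists_exp.choose

theorem exp_two_smul (x : E) : K.exp ((2 : ℝ) • x) = K.exp x * K.exp x :=
  K.exists_exp.choose_spec.1 x

theorem eventually_exp_eq : ∀ᶠ x in 𝓝 0, K.exp x = K.chart.symm x :=
  K.exists_exp.choose_spec.2

theorem exp_zero : K.exp 0 = 1 := by
  rw [K.eventually_exp_eq.self_of_nhds, K.symm_zero]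

theorem eventually_chart_exp : ∀ᶠ x in 𝓝 (0 : E), K.chart (K.exp x) = x := by
  filter_upwards [K.eventually_exp_eq, K.eventually_chart_symm] with x h1 h2
  rw [h1, h2]

theorem eventually_exp_chart : ∀ᶠ g in 𝓝 (1 : N), K.exp (K.chart g) = g := by
  filter_upwards [K.tendsto_chart.eventually K.eventually_exp_eq, K.eventually_symm_chart]
    with g h1 h2
  rw [h1, h2]

theorem continuous_exp : Continuous K.exp := by
  have h0 : ∀ᶠ x in 𝓝 (0 : E), ContinuousAt K.exp x := by
    filter_upwards [K.eventually_exp_eq.eventually_nhds,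
      K.chart.open_target.mem_nhds K.zero_mem] with x h1 h2
    exact (K.chart.continuousAt_symm h2).congr (h1.mono fun _ h => h.symm)
  rw [continuous_iff_continuousAt]
  intro x
  obtain ⟨n, hn⟩ := ((tendsto_two_pow_inv_smul x).eventually h0).exists
  have h1 : ContinuousAt (fun y : E => K.exp (((2 : ℝ) ^ n)⁻¹ • y)) x :=
    ContinuousAt.comp (f := fun y : E => ((2 : ℝ) ^ n)⁻¹ • y) hn
      (continuous_const_smul _).continuousAt
  exact (h1.pow (2 ^ n)).congr (Eventually.of_forall fun y =>
    (eq_two_pow_of_doubling K.exp_two_smul n y).symm)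

theorem tendsto_exp : Tendsto K.exp (𝓝 0) (𝓝 1) := by
  simpa [K.exp_zero] using K.continuous_exp.tendsto 0

variable {F : Type*} [NormedAddCommGroup F] [NormedSpace ℝ F]

/-- A map from a vector space to the group that sends `0` to the identity, with derivative `L`
there (in canonical coordinates). -/
structure HasTangent (u : F → N) (L : F →L[ℝ] E) : Prop where
  map_zero : u 0 = 1
  tendsto : Tendsto u (𝓝 0) (𝓝 1)
  hasFDerivAt : HasFDerivAt (fun x => K.chart (u x)) L 0

variable {K} in
theorem HasTangent.unique {u : F → N} {L L' : F →L[ℝ] E} (h : K.HasTangent u L)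
    (h' : K.HasTangent u L') : L = L' :=
  h.hasFDerivAt.unique h'.hasFDerivAt

theorem hasTangent_one : K.HasTangent (fun _ : F => (1 : N)) 0 :=
  ⟨rfl, tendsto_const_nhds, hasFDerivAt_const _ _⟩

theorem hasTangent_exp (A : F →L[ℝ] E) : K.HasTangent (fun x => K.exp (A x)) A := by
  have hA : Tendsto A (𝓝 0) (𝓝 0) := by simpa using A.continuous.tendsto 0
  refine ⟨by simp [K.exp_zero], K.tendsto_exp.comp hA, ?_⟩
  exact A.hasFDerivAt.congr_of_eventuallyEq (hA.eventually K.eventually_chart_exp)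

theorem hasFDerivAt_mul :
    HasFDerivAt (fun p : E × E => K.chart (K.chart.symm p.1 * K.chart.symm p.2))
      (ContinuousLinearMap.fst ℝ E E + ContinuousLinearMap.snd ℝ E E) 0 :=
  hasFDerivAt_add_of_unit (K.contDiffAt_mul.differentiableAt one_ne_zero)
    (by filter_upwards [K.eventually_chart_symm] with x hx; simpa [K.symm_zero] using hx)
    (by filter_upwards [K.eventually_chart_symm] with x hx; simpa [K.symm_zero] using hx)

variable {K}

theorem HasTangent.chart_zero {u : F → N} {L : F →L[ℝ] E} (h : K.HasTangent u L) :
    K.chart (u 0) = 0 := by rw [h.map_zero, K.map_one]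

theorem HasTangent.mul {u v : F → N} {L L' : F →L[ℝ] E} (hu : K.HasTangent u L)
    (hv : K.HasTangent v L') : K.HasTangent (fun x => u x * v x) (L + L') := by
  refine ⟨by rw [hu.map_zero, hv.map_zero, one_mul], tendsto_mul_one_one hu.tendsto hv.tendsto, ?_⟩
  have h1 := hu.hasFDerivAt.prodMk hv.hasFDerivAt
  have h2 : HasFDerivAt (fun p : E × E => K.chart (K.chart.symm p.1 * K.chart.symm p.2))
      (ContinuousLinearMap.fst ℝ E E + ContinuousLinearMap.snd ℝ E E)
      (K.chart (u 0), K.chart (v 0)) := by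
    rw [hu.chart_zero, hv.chart_zero]; exact K.hasFDerivAt_mul
  refine ((h2.comp (0 : F) h1).congr_of_eventuallyEq ?_).congr_fderiv (by ext x; simp)
  filter_upwards [hu.tendsto.eventually K.eventually_symm_chart,
    hv.tendsto.eventually K.eventually_symm_chart] with x hx hy
  simp [hx, hy]

/-- The derivative of a group-valued map composed with a self-map of the group. -/
theorem HasTangent.comp_self {u : F → N} {L : F →L[ℝ] E} (hu : K.HasTangent u L) {f : N → N}
    (hf1 : f 1 = 1) (hfc : ContinuousAt f 1)
    (hf : DifferentiableAt ℝ (fun x => K.chart (f (K.chart.symm x))) 0) :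
    K.HasTangent (fun x => f (u x))
      ((fderiv ℝ (fun x => K.chart (f (K.chart.symm x))) 0).comp L) := by
  have hfc' : Tendsto f (𝓝 1) (𝓝 1) := by simpa [ContinuousAt, hf1] using hfc
  refine ⟨by rw [hu.map_zero, hf1], hfc'.comp hu.tendsto, ?_⟩
  have h1 : HasFDerivAt (fun x => K.chart (f (K.chart.symm x)))
      (fderiv ℝ (fun x => K.chart (f (K.chart.symm x))) 0) (K.chart (u 0)) := by
    rw [hu.chart_zero]; exact hf.hasFDerivAt
  refine (HasFDerivAt.comp (0 : F) h1 hu.hasFDerivAt).congr_of_eventuallyEq ?_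
  filter_upwards [hu.tendsto.eventually K.eventually_symm_chart] with x hx
  simp [hx]

/-- Differentiability of inversion is known; its value comes from differentiating `u * u⁻¹ = 1`. -/
theorem HasTangent.inv {u : F → N} {L : F →L[ℝ] E} (hu : K.HasTangent u L) :
    K.HasTangent (fun x => (u x)⁻¹) (-L) := by
  have h1 := hu.comp_self (f := fun g => g⁻¹) inv_one continuous_inv.continuousAt
    K.differentiableAt_inv
  have h2 := hu.mul h1
  simp only [mul_inv_cancel] at h2
  have h3 := h2.unique K.hasTangent_one
  rwa [eq_neg_of_add_eq_zero_right h3] at h1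

variable (K) in
/-- The adjoint representation. -/
noncomputable def Ad (g : N) : E →L[ℝ] E :=
  fderiv ℝ (fun x => K.chart (g * K.chart.symm x * g⁻¹)) 0

theorem HasTangent.conj {u : F → N} {L : F →L[ℝ] E} (hu : K.HasTangent u L) (g : N) :
    K.HasTangent (fun x => g * u x * g⁻¹) ((K.Ad g).comp L) :=
  hu.comp_self (f := fun x => g * x * g⁻¹) (by simp)
    (Continuous.continuousAt (by fun_prop)) (K.differentiableAt_conj g)

/-- A map to the group that commutes with doubling and is differentiable at `0` is given by the
exponential map. -/
theorem HasTangent.eq_exp {u : F → N} {L : F →L[ℝ] E} (hu : K.HasTangent u L)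
    (h2 : ∀ x, u ((2 : ℝ) • x) = u x * u x) (x : F) : u x = K.exp (L x) := by
  have hL : Tendsto L (𝓝 0) (𝓝 0) := by simpa using L.continuous.tendsto 0
  refine eq_of_doubling_of_eventuallyEq (v := fun x => K.exp (L x)) h2
    (fun x => by rw [map_smul, K.exp_two_smul]) ?_ x
  have h3 : ∀ᶠ x in 𝓝 0, K.chart (u x) = L x := by
    refine eventually_eq_of_doubling hu.hasFDerivAt ?_
    filter_upwards [hu.tendsto.eventually K.map_sq] with x hx
    rw [h2, hx]
  filter_upwards [h3, hu.tendsto.eventually K.eventually_exp_chart] with x h4 h5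
  rw [← h4, h5]

variable (K)

theorem conj_exp (g : N) (x : E) : g * K.exp x * g⁻¹ = K.exp (K.Ad g x) :=
  ((K.hasTangent_exp (ContinuousLinearMap.id ℝ E)).conj g).eq_exp
    (fun x => by simp only [ContinuousLinearMap.id_apply, K.exp_two_smul]; group) x

theorem exp_neg (x : E) : K.exp (-x) = (K.exp x)⁻¹ :=
  (((K.hasTangent_exp (ContinuousLinearMap.id ℝ E)).inv).eq_exp
    (fun x => by simp only [ContinuousLinearMap.id_apply, K.exp_two_smul]; group) x).symm

/-- Only local injectivity of `exp` is available here, so vectors are compared after scaling them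
into a small neighbourhood of `0`. -/
theorem eq_of_exp_smul_eq {x y : E}
    (h : ∀ n : ℕ, K.exp (((2 : ℝ) ^ n)⁻¹ • x) = K.exp (((2 : ℝ) ^ n)⁻¹ • y)) : x = y := by
  obtain ⟨n, hx, hy⟩ := (((tendsto_two_pow_inv_smul x).eventually K.eventually_chart_exp).and
    ((tendsto_two_pow_inv_smul y).eventually K.eventually_chart_exp)).exists
  rw [h n, hy] at hx
  exact (smul_right_injective E (by positivity : ((2 : ℝ) ^ n)⁻¹ ≠ 0) hx).symm

theorem Ad_exp_self (x : E) : K.Ad (K.exp x) x = x := by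
  refine K.eq_of_exp_smul_eq fun n => ?_
  rw [← map_smul, ← K.conj_exp]
  rw [eq_two_pow_of_doubling K.exp_two_smul n x]
  exact mul_inv_eq_iff_eq_mul.2 ((Commute.refl _).pow_left _)

theorem commute_exp_smul (x : E) (s t : ℝ) : Commute (K.exp (s • x)) (K.exp (t • x)) := by
  rcases eq_or_ne s 0 with rfl | hs
  · rw [zero_smul, K.exp_zero]; exact Commute.one_left _
  · have h := K.conj_exp (K.exp (s • x)) ((t / s) • s • x)
    rw [map_smul, K.Ad_exp_self, smul_smul, div_mul_cancel₀ t hs] at h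
    exact mul_inv_eq_iff_eq_mul.1 h

/-- Commutation makes `r ↦ exp (r • x) * exp (r • y)` compatible with doubling, so it is the
exponential of its derivative. -/
theorem exp_add_of_commute {x y : E} (h : ∀ r : ℝ, Commute (K.exp (r • x)) (K.exp (r • y))) :
    K.exp (x + y) = K.exp x * K.exp y := by
  have h1 := ((K.hasTangent_exp ((ContinuousLinearMap.id ℝ ℝ).smulRight x)).mul
    (K.hasTangent_exp ((ContinuousLinearMap.id ℝ ℝ).smulRight y))).eq_exp (fun r => by
      simp only [ContinuousLinearMap.smulRight_apply, ContinuousLinearMap.id_apply, mul_smul,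
        smul_eq_mul, K.exp_two_smul]
      exact (h r).mul_mul_mul_comm _ _) 1
  simpa using h1.symm

theorem exp_add_smul (x : E) (s t : ℝ) :
    K.exp ((s + t) • x) = K.exp (s • x) * K.exp (t • x) := by
  rw [add_smul]
  refine K.exp_add_of_commute fun r => ?_
  rw [smul_smul, smul_smul]
  exact K.commute_exp_smul x _ _

theorem exp_nsmul (n : ℕ) (x : E) : K.exp ((n : ℝ) • x) = K.exp x ^ n := by
  induction n with
  | zero => simp [K.exp_zero]
  | succ n ih => rw [Nat.cast_succ, K.exp_add_smul, ih, one_smul, pow_succ]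

theorem Ad_mul (g h : N) : K.Ad (g * h) = K.Ad g * K.Ad h := by
  ext x
  refine K.eq_of_exp_smul_eq fun n => ?_
  rw [mul_apply_eq_comp, ← map_smul, ← map_smul, ← map_smul, ← K.conj_exp,
    ← K.conj_exp, ← K.conj_exp]
  group

theorem Ad_one : K.Ad 1 = 1 := by
  ext x
  refine K.eq_of_exp_smul_eq fun n => ?_
  rw [← map_smul, ← K.conj_exp]
  simp

/-- Near the identity `Ad` is a partial derivative of conjugation, which is `C¹` in coordinates;
multiplicativity carries continuity from `1` to every point. -/
theorem continuous_Ad : Continuous K.Ad := by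
  let m : E × E → E := fun p => K.chart (K.chart.symm p.1 * K.chart.symm p.2)
  let c : E × E → E := fun p =>
    K.chart (K.chart.symm p.1 * K.chart.symm p.2 * (K.chart.symm p.1)⁻¹)
  have hm0 : m 0 = 0 := by simp [m, K.symm_zero, K.map_one]
  have hmm : ContDiffAt ℝ 1 (fun p : E × E => m (m p, -p.1)) 0 := by
    refine ContDiffAt.comp (g := m) (f := fun p : E × E => (m p, -p.1)) (0 : E × E) ?_
      (K.contDiffAt_mul.prodMk contDiffAt_fst.neg)
    rw [hm0, Prod.fst_zero, neg_zero]
    exact K.contDiffAt_mul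
  have hfst : Tendsto (fun p : E × E => p.1) (𝓝 0) (𝓝 0) := continuous_fst.tendsto 0
  have hsnd : Tendsto (fun p : E × E => p.2) (𝓝 0) (𝓝 0) := continuous_snd.tendsto 0
  have hneg : Tendsto (fun p : E × E => -p.1) (𝓝 0) (𝓝 0) := by simpa using hfst.neg
  -- Inversion is negation in these coordinates, so conjugation is composed of two multiplications
  -- and a sign.
  have hc : ContDiffAt ℝ 1 c 0 := by
    refine hmm.congr_of_eventuallyEq ?_
    filter_upwards [hfst.eventually K.eventually_exp_eq, hneg.eventually K.eventually_exp_eq,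
      (tendsto_mul_one_one (K.tendsto_symm.comp hfst) (K.tendsto_symm.comp hsnd)).eventually
        K.eventually_symm_chart] with p h1 h2 h3
    simp only [Function.comp_apply] at h3
    simp only [m, c]
    rw [h3, ← h1, ← h2, K.exp_neg]
  have hcd : ∀ᶠ p in 𝓝 (0 : E × E), DifferentiableAt ℝ c p :=
    (hc.eventually (by simp)).mono fun p hp => hp.differentiableAt one_ne_zero
  have hinl : Tendsto (fun a : E => (a, (0 : E))) (𝓝 0) (𝓝 0) :=
    (Continuous.prodMk_left (0 : E)).tendsto 0
  have hAd : ∀ᶠ a in 𝓝 (0 : E), K.Ad (K.chart.symm a) =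
      (fderiv ℝ c (a, 0)).comp (ContinuousLinearMap.inr ℝ E E) := by
    filter_upwards [hinl.eventually hcd] with a ha
    have h1 : HasFDerivAt (fun x : E => (a, x)) (ContinuousLinearMap.inr ℝ E E) 0 :=
      hasFDerivAt_prodMk_right a 0
    exact (HasFDerivAt.comp (g := c) (0 : E) ha.hasFDerivAt h1).fderiv
  have hlim : Tendsto (fun a : E => K.Ad (K.chart.symm a)) (𝓝 0) (𝓝 1) := by
    have h1 : ContinuousAt (fderiv ℝ c) 0 :=
      (hc.fderiv_right (m := 0) (by norm_num)).continuousAt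
    have h2 : Tendsto (fun a : E => (fderiv ℝ c (a, 0)).comp (ContinuousLinearMap.inr ℝ E E))
        (𝓝 0) (𝓝 ((fderiv ℝ c 0).comp (ContinuousLinearMap.inr ℝ E E))) :=
      ((continuous_id.clm_comp_const _).tendsto _).comp (h1.tendsto.comp hinl)
    have h3 : (fderiv ℝ c 0).comp (ContinuousLinearMap.inr ℝ E E) = 1 := by
      have := hAd.self_of_nhds
      rw [K.symm_zero, K.Ad_one] at this
      exact this.symm
    rw [h3] at h2
    exact h2.congr' (hAd.mono fun _ h => h.symm)
  have hone : Tendsto K.Ad (𝓝 1) (𝓝 1) := by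
    refine (hlim.comp K.tendsto_chart).congr' ?_
    filter_upwards [K.eventually_symm_chart] with g hg
    simp [hg]
  rw [continuous_iff_continuousAt]
  intro g
  have h1 : Tendsto (fun h : N => g⁻¹ * h) (𝓝 g) (𝓝 1) := by
    simpa using (continuous_const_mul g⁻¹).tendsto g
  have h2 := (hone.comp h1).const_mul (K.Ad g)
  rw [mul_one] at h2
  refine h2.congr fun h => ?_
  rw [Function.comp_apply, ← K.Ad_mul, mul_inv_cancel_left]

/-- Passing from `u` to `⁅g, u⁆` multiplies the derivative by `Ad g - 1` and moves down the lower
central series; after `c` steps from `exp` the map is constant. -/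
theorem Ad_sub_one_pow_eq_zero {c : ℕ} (hc : (⊤ : Subgroup N).lowerCentralSeries c = ⊥) (g : N) :
    (K.Ad g - 1) ^ c = 0 := by
  have key : ∀ k : ℕ, ∃ u : E → N, (∀ x, u x ∈ (⊤ : Subgroup N).lowerCentralSeries k) ∧
      K.HasTangent u ((K.Ad g - 1) ^ k) := by
    intro k
    induction k with
    | zero => exact ⟨K.exp, fun _ => trivial, K.hasTangent_exp (ContinuousLinearMap.id ℝ E)⟩
    | succ k ih =>
      obtain ⟨u, hu, hut⟩ := ih
      refine ⟨fun x => ⁅g, u x⁆, fun x => ?_, ?_⟩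
      · rw [Subgroup.lowerCentralSeries_succ, Subgroup.commutator_comm]
        exact Subgroup.commutator_mem_commutator trivial (hu x)
      · have h := (hut.conj g).mul hut.inv
        simp only [commutatorElement_def]
        convert h using 1
        rw [pow_succ', sub_mul, one_mul, sub_eq_add_neg]
        rfl
  obtain ⟨u, hu, hut⟩ := key c
  have h1 : u = fun _ => 1 := by
    ext x
    have := hu x
    rwa [hc, Subgroup.mem_bot] at this
  rw [h1] at hut
  exact hut.unique K.hasTangent_one

end CanonicalCoordinates

/-! ### One-parameter groups of unipotent elements -/

section UnipotentOneParameter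

open Filter Topology

/-- The generalized binomial coefficient `t (t - 1) ⋯ (t - j + 1) / j!`. -/
noncomputable def binomialCoeff (j : ℕ) (t : ℝ) : ℝ :=
  (descPochhammer ℝ j).eval t / (j.factorial : ℝ)

theorem binomialCoeff_natCast (j n : ℕ) : binomialCoeff j n = (n.choose j : ℝ) := by
  rw [binomialCoeff, descPochhammer_eval_eq_descFactorial, Nat.descFactorial_eq_factorial_mul_choose,
    Nat.cast_mul, mul_div_cancel_left₀ _ (by exact_mod_cast j.factorial_ne_zero)]

theorem binomialCoeff_zero (t : ℝ) : binomialCoeff 0 t = 1 := by simp [binomialCoeff]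

theorem continuous_binomialCoeff (j : ℕ) : Continuous (binomialCoeff j) :=
  (descPochhammer ℝ j).continuous.div_const _

variable {R : Type*} [NormedRing R] [NormedAlgebra ℝ R]

theorem one_add_pow_of_nilpotent {w : R} {c : ℕ} (hw : w ^ c = 0) (n : ℕ) :
    (1 + w) ^ n = ∑ j ∈ Finset.range c, (n.choose j : ℝ) • w ^ j := by
  have h1 : (1 + w) ^ n = ∑ j ∈ Finset.range (n + 1), (n.choose j : ℝ) • w ^ j := by
    rw [add_comm, (Commute.one_right w).add_pow]
    refine Finset.sum_congr rfl fun j _ => ?_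
    rw [one_pow, mul_one, ← Nat.cast_comm, ← nsmul_eq_mul, Nat.cast_smul_eq_nsmul]
  have h2 : ∀ m, n + 1 ≤ m → ∑ j ∈ Finset.range (n + 1), (n.choose j : ℝ) • w ^ j =
      ∑ j ∈ Finset.range m, (n.choose j : ℝ) • w ^ j := fun m hm =>
    Finset.sum_subset (Finset.range_mono hm) fun j _ hj => by
      rw [Nat.choose_eq_zero_of_lt (by simpa using hj), Nat.cast_zero, zero_smul]
  have h3 : ∀ m, c ≤ m → ∑ j ∈ Finset.range c, (n.choose j : ℝ) • w ^ j =
      ∑ j ∈ Finset.range m, (n.choose j : ℝ) • w ^ j := fun m hm =>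
    Finset.sum_subset (Finset.range_mono hm) fun j _ hj => by
      rw [pow_eq_zero_of_le (by simpa using hj) hw, smul_zero]
  rw [h1, h2 _ (le_max_left (n + 1) c), h3 _ (le_max_right (n + 1) c)]

/-- A continuous one-parameter group of unipotent elements is polynomial, determined by its value
at `1`. -/
theorem eq_sum_binomialCoeff {f : ℝ → R} (hf : Continuous f) (hadd : ∀ s t, f (s + t) = f s * f t)
    (h0 : f 0 = 1) {c : ℕ} (hc : ∀ t, (f t - 1) ^ c = 0) {t : ℝ} (ht : 0 ≤ t) :
    f t = ∑ j ∈ Finset.range c, binomialCoeff j t • (f 1 - 1) ^ j := by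
  have hmul : ∀ (n : ℕ) (s : ℝ), f (n * s) = f s ^ n := by
    intro n s
    induction n with
    | zero => simp [h0]
    | succ n ih => rw [Nat.cast_succ, add_mul, one_mul, hadd, ih, pow_succ]
  have hpow : ∀ (n : ℕ) (s : ℝ), f (n * s) =
      ∑ j ∈ Finset.range c, binomialCoeff j n • (f s - 1) ^ j := by
    intro n s
    have := one_add_pow_of_nilpotent (hc s) n
    rw [add_sub_cancel] at this
    simp only [binomialCoeff_natCast]
    rw [hmul, this]
  -- The expansions in powers of `f (1 / m) - 1` and of `f 1 - 1` agree at all natural numbers,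
  -- hence, tested against linear functionals, as polynomials; they are then compared at `a / m`.
  have hrat : ∀ a m : ℕ, m ≠ 0 → f ((a : ℝ) / m) =
      ∑ j ∈ Finset.range c, binomialCoeff j ((a : ℝ) / m) • (f 1 - 1) ^ j := by
    intro a m hm
    have hm' : (m : ℝ) ≠ 0 := Nat.cast_ne_zero.2 hm
    rw [← sub_eq_zero, ← Module.forall_dual_apply_eq_zero_iff ℝ]
    intro ℓ
    let b : ℕ → Polynomial ℝ := fun j => Polynomial.C ((j.factorial : ℝ)⁻¹) * descPochhammer ℝ j
    have hb : ∀ j s, (b j).eval s = binomialCoeff j s := fun j s => by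
      simp [b, binomialCoeff, div_eq_inv_mul]
    let Q : Polynomial ℝ := ∑ j ∈ Finset.range c, (Polynomial.C (ℓ ((f (1 / m) - 1) ^ j)) *
      (b j).comp (Polynomial.C (m : ℝ) * Polynomial.X) - Polynomial.C (ℓ ((f 1 - 1) ^ j)) * b j)
    have hQ : ∀ s, Q.eval s = ℓ ((∑ j ∈ Finset.range c, binomialCoeff j (m * s) •
        (f (1 / m) - 1) ^ j) - ∑ j ∈ Finset.range c, binomialCoeff j s • (f 1 - 1) ^ j) := by
      intro s
      simp only [Q, Polynomial.eval_finsetSum, map_sub, map_sum, map_smul, smul_eq_mul,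
        Polynomial.eval_sub, Polynomial.eval_mul, Polynomial.eval_C, Polynomial.eval_comp,
        Polynomial.eval_X, hb, Finset.sum_sub_distrib]
      congr 1 <;> exact Finset.sum_congr rfl fun j _ => mul_comm _ _
    have hQ0 : Q = 0 := by
      apply Polynomial.eq_zero_of_infinite_isRoot
      refine Set.Infinite.mono ?_ (Set.infinite_range_of_injective (Nat.cast_injective (R := ℝ)))
      rintro _ ⟨n, rfl⟩
      change Q.eval (n : ℝ) = 0
      have h1 := hpow (m * n) (1 / m)
      have h2 := hpow n 1
      rw [Nat.cast_mul] at h1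
      rw [hQ, ← h1, ← h2]
      have : (m : ℝ) * n * (1 / m) = n * 1 := by field_simp
      rw [this, sub_self, map_zero]
    have h3 := hQ ((a : ℝ) / m)
    rw [hQ0, Polynomial.eval_zero, mul_div_cancel₀ _ hm', ← hpow a (1 / m), mul_one_div] at h3
    exact h3.symm
  have hlim : Tendsto (fun n : ℕ => ((⌊t * n⌋₊ : ℕ) : ℝ) / n) atTop (𝓝 t) :=
    (tendsto_nat_floor_mul_div_atTop ht).comp tendsto_natCast_atTop_atTop
  have hcont : Continuous fun s => ∑ j ∈ Finset.range c, binomialCoeff j s • (f 1 - 1) ^ j :=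
    continuous_finsetSum _ fun j _ => (continuous_binomialCoeff j).smul continuous_const
  refine tendsto_nhds_unique ((hf.tendsto t).comp hlim) (((hcont.tendsto t).comp hlim).congr' ?_)
  filter_upwards [eventually_ne_atTop 0] with n hn
  exact (hrat _ n hn).symm

/-- The polynomial that expresses `∫ s in 0..1, U ^ s` in terms of a unipotent element `U`. -/
noncomputable def unipotentMean (c : ℕ) (U : R) : R :=
  ∑ j ∈ Finset.range (c + 1), (∫ s in (0 : ℝ)..1, binomialCoeff j s) • (U - 1) ^ j

theorem continuous_unipotentMean (c : ℕ) : Continuous (unipotentMean c : R → R) :=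
  continuous_finsetSum _ fun _ _ => ((continuous_id.sub continuous_const).pow _).const_smul _

/-- The constant term is `1` and the rest is nilpotent. Summing over `range (c + 1)` keeps this term
even for `c = 0`. -/
theorem isUnit_unipotentMean {c : ℕ} {U : R} (hU : (U - 1) ^ c = 0) :
    IsUnit (unipotentMean c U) := by
  rw [unipotentMean, Finset.sum_range_succ']
  simp only [binomialCoeff_zero, intervalIntegral.integral_const, sub_zero, one_smul, pow_zero]
  refine IsNilpotent.isUnit_add_one ?_
  have : ∑ j ∈ Finset.range c, (∫ s in (0 : ℝ)..1, binomialCoeff (j + 1) s) • (U - 1) ^ (j + 1) =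
      (U - 1) * ∑ j ∈ Finset.range c, (∫ s in (0 : ℝ)..1, binomialCoeff (j + 1) s) •
        (U - 1) ^ j := by
    rw [Finset.mul_sum]
    exact Finset.sum_congr rfl fun j _ => by rw [pow_succ', mul_smul_comm]
  rw [this]
  refine ⟨c, ?_⟩
  rw [Commute.mul_pow, hU, zero_mul]
  exact Commute.sum_right _ _ _ fun j _ => ((Commute.refl _).pow_right j).smul_right _

theorem integral_eq_unipotentMean [CompleteSpace R] {f : ℝ → R} (hf : Continuous f)
    (hadd : ∀ s t, f (s + t) = f s * f t) (h0 : f 0 = 1) {c : ℕ} (hc : ∀ t, (f t - 1) ^ c = 0) :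
    ∫ s in (0 : ℝ)..1, f s = unipotentMean c (f 1) := by
  have hc' : ∀ t, (f t - 1) ^ (c + 1) = 0 := fun t => by rw [pow_succ, hc, zero_mul]
  have h1 : ∫ s in (0 : ℝ)..1, f s = ∫ s in (0 : ℝ)..1,
      ∑ j ∈ Finset.range (c + 1), binomialCoeff j s • (f 1 - 1) ^ j := by
    refine intervalIntegral.integral_congr fun s hs => ?_
    rw [Set.uIcc_of_le zero_le_one] at hs
    exact eq_sum_binomialCoeff hf hadd h0 hc' hs.1
  rw [h1, intervalIntegral.integral_finsetSum, unipotentMean]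
  · exact Finset.sum_congr rfl fun j _ => intervalIntegral.integral_smul_const _ _
  · exact fun j _ =>
      ((continuous_binomialCoeff j).smul continuous_const).intervalIntegrable _ _

end UnipotentOneParameter

/-! ### The differential of the exponential map -/

namespace CanonicalCoordinates

set_option linter.unusedSectionVars false

open Filter Topology

variable {E N : Type*} [NormedAddCommGroup E] [NormedSpace ℝ E] [Group N] [TopologicalSpace N]
  [IsTopologicalGroup N] (K : CanonicalCoordinates E N)
  {F : Type*} [NormedAddCommGroup F] [NormedSpace ℝ F]

/-- The strict version of `CanonicalCoordinates.HasTangent`. -/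
structure HasStrictTangent (u : F → N) (L : F →L[ℝ] E) : Prop where
  map_zero : u 0 = 1
  tendsto : Tendsto u (𝓝 0) (𝓝 1)
  hasStrictFDerivAt : HasStrictFDerivAt (fun x => K.chart (u x)) L 0

variable {K}

theorem HasStrictTangent.hasTangent {u : F → N} {L : F →L[ℝ] E} (h : K.HasStrictTangent u L) :
    K.HasTangent u L :=
  ⟨h.map_zero, h.tendsto, h.hasStrictFDerivAt.hasFDerivAt⟩

theorem HasStrictTangent.mul {u v : F → N} {L L' : F →L[ℝ] E} (hu : K.HasStrictTangent u L)
    (hv : K.HasStrictTangent v L') : K.HasStrictTangent (fun x => u x * v x) (L + L') := by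
  refine ⟨by rw [hu.map_zero, hv.map_zero, one_mul], tendsto_mul_one_one hu.tendsto hv.tendsto, ?_⟩
  have h1 := hu.hasStrictFDerivAt.prodMk hv.hasStrictFDerivAt
  have h2 : HasStrictFDerivAt (fun p : E × E => K.chart (K.chart.symm p.1 * K.chart.symm p.2))
      (ContinuousLinearMap.fst ℝ E E + ContinuousLinearMap.snd ℝ E E)
      (K.chart (u 0), K.chart (v 0)) := by
    rw [hu.hasTangent.chart_zero, hv.hasTangent.chart_zero]
    exact K.contDiffAt_mul.hasStrictFDerivAt' K.hasFDerivAt_mul one_ne_zero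
  refine ((h2.comp (0 : F) h1).congr_of_eventuallyEq ?_).congr_fderiv (by ext x; simp)
  filter_upwards [hu.tendsto.eventually K.eventually_symm_chart,
    hv.tendsto.eventually K.eventually_symm_chart] with x hx hy
  simp [hx, hy]

theorem HasStrictTangent.conj {u : F → N} {L : F →L[ℝ] E} (hu : K.HasStrictTangent u L) (g : N) :
    K.HasStrictTangent (fun x => g * u x * g⁻¹) ((K.Ad g).comp L) := by
  have h := hu.hasTangent.conj g
  refine ⟨h.map_zero, h.tendsto, ?_⟩
  refine ((K.Ad g).hasStrictFDerivAt.comp (0 : F) hu.hasStrictFDerivAt).congr_of_eventuallyEq ?_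
  have h0 : Tendsto (fun x => K.Ad g (K.chart (u x))) (𝓝 0) (𝓝 0) := by
    have := ((K.Ad g).continuous.tendsto 0).comp (K.tendsto_chart.comp hu.tendsto)
    rw [_root_.map_zero] at this
    exact this
  filter_upwards [hu.tendsto.eventually K.eventually_exp_chart,
    h0.eventually K.eventually_chart_exp] with x h1 h2
  rw [← K.conj_exp, h1] at h2
  exact h2.symm

theorem HasStrictTangent.comp_linear {F' : Type*} [NormedAddCommGroup F'] [NormedSpace ℝ F']
    {u : F → N} {L : F →L[ℝ] E} (hu : K.HasStrictTangent u L) (A : F' →L[ℝ] F) :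
    K.HasStrictTangent (fun x => u (A x)) (L.comp A) := by
  have hA : Tendsto A (𝓝 0) (𝓝 0) := by simpa using A.continuous.tendsto 0
  refine ⟨by simp [hu.map_zero], hu.tendsto.comp hA, ?_⟩
  have h : HasStrictFDerivAt (fun x => K.chart (u x)) L (A 0) := by
    rw [A.map_zero]
    exact hu.hasStrictFDerivAt
  exact h.comp (0 : F') A.hasStrictFDerivAt

variable (K)

/-- In coordinates the map is the product of `-z` and `z + w`: it is `C¹` in both variables, with
derivative `w` at the origin. -/
theorem exists_strictTangent_exp_near_zero : ∃ J : E → E →L[ℝ] E, Tendsto J (𝓝 0) (𝓝 1) ∧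
    ∀ᶠ z in 𝓝 (0 : E), K.HasStrictTangent (fun w => (K.exp z)⁻¹ * K.exp (z + w)) (J z) := by
  let m : E × E → E := fun p => K.chart (K.chart.symm p.1 * K.chart.symm p.2)
  let A : E × E →L[ℝ] E × E := (-ContinuousLinearMap.fst ℝ E E).prod
    (ContinuousLinearMap.fst ℝ E E + ContinuousLinearMap.snd ℝ E E)
  let H : E × E → E := fun p => m (A p)
  have hH : ContDiffAt ℝ 1 H 0 := by
    refine ContDiffAt.comp (g := m) (0 : E × E) ?_ A.contDiff.contDiffAt
    rw [map_zero]
    exact K.contDiffAt_mul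
  have hH0 : fderiv ℝ H 0 = ContinuousLinearMap.snd ℝ E E := by
    have h1 : HasFDerivAt m (ContinuousLinearMap.fst ℝ E E + ContinuousLinearMap.snd ℝ E E)
        (A 0) := by rw [map_zero]; exact K.hasFDerivAt_mul
    have h2 : HasFDerivAt H _ 0 := h1.comp (0 : E × E) A.hasFDerivAt
    rw [h2.fderiv]
    ext x <;> simp [A]
  have hinl : Tendsto (fun a : E => (a, (0 : E))) (𝓝 0) (𝓝 0) :=
    (Continuous.prodMk_left (0 : E)).tendsto 0
  have hHd : ∀ᶠ p in 𝓝 (0 : E × E), HasStrictFDerivAt H (fderiv ℝ H p) p :=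
    (hH.eventually (by simp)).mono fun p hp => hp.hasStrictFDerivAt one_ne_zero
  refine ⟨fun z => (fderiv ℝ H (z, 0)).comp (ContinuousLinearMap.inr ℝ E E), ?_, ?_⟩
  · have h1 : ContinuousAt (fderiv ℝ H) 0 :=
      (hH.fderiv_right (m := 0) (by norm_num)).continuousAt
    have h2 : Tendsto (fun a : E => (fderiv ℝ H (a, 0)).comp (ContinuousLinearMap.inr ℝ E E))
        (𝓝 0) (𝓝 ((fderiv ℝ H 0).comp (ContinuousLinearMap.inr ℝ E E))) :=
      ((continuous_id.clm_comp_const _).tendsto _).comp (h1.tendsto.comp hinl)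
    rw [hH0] at h2
    exact h2
  · have hneg : Tendsto (fun z : E => -z) (𝓝 0) (𝓝 0) := by
      simpa using (continuous_neg (G := E)).tendsto 0
    filter_upwards [hinl.eventually hHd, K.eventually_exp_eq.eventually_nhds,
      hneg.eventually K.eventually_exp_eq] with z h1 h2 h3
    have hzw : Tendsto (fun w : E => z + w) (𝓝 0) (𝓝 z) := by
      simpa using (continuous_const_add z).tendsto (0 : E)
    refine ⟨by simp, ?_, ?_⟩
    · have := (K.continuous_exp.tendsto z).comp hzw
      simpa using this.const_mul (K.exp z)⁻¹
    · have h4 : HasStrictFDerivAt (fun w : E => (z, w)) (ContinuousLinearMap.inr ℝ E E) 0 :=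
        (hasStrictFDerivAt_const z (0 : E)).prodMk (hasStrictFDerivAt_id 0)
      refine (HasStrictFDerivAt.comp (g := H) (0 : E) h1 h4).congr_of_eventuallyEq ?_
      filter_upwards [hzw.eventually h2] with w hw
      simp only [H, A, m, ← K.exp_neg, h3, hw]
      simp

theorem hasStrictTangent_exp_add_smul {x : E} {a b : ℝ} {L L' : E →L[ℝ] E}
    (ha : K.HasStrictTangent (fun y => (K.exp (a • x))⁻¹ * K.exp (a • (x + y))) L)
    (hb : K.HasStrictTangent (fun y => (K.exp (b • x))⁻¹ * K.exp (b • (x + y))) L') :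
    K.HasStrictTangent (fun y => (K.exp ((a + b) • x))⁻¹ * K.exp ((a + b) • (x + y)))
      (K.Ad (K.exp (b • x))⁻¹ * L + L') := by
  have h := (ha.conj (K.exp (b • x))⁻¹).mul hb
  have e : (fun y => (K.exp ((a + b) • x))⁻¹ * K.exp ((a + b) • (x + y))) = fun y =>
      (K.exp (b • x))⁻¹ * ((K.exp (a • x))⁻¹ * K.exp (a • (x + y))) * (K.exp (b • x))⁻¹⁻¹ *
        ((K.exp (b • x))⁻¹ * K.exp (b • (x + y))) := by
    funext y
    rw [K.exp_add_smul, K.exp_add_smul]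
    group
  rw [e]
  exact h

/-- The differential of the exponential map along a ray. -/
theorem exists_dexp (x : E) : ∃ G : ℝ → E →L[ℝ] E, G 0 = 0 ∧
    (∀ t, HasDerivAt G (K.Ad (K.exp (t • x))⁻¹) t) ∧
    ∀ t, K.HasStrictTangent (fun y => (K.exp (t • x))⁻¹ * K.exp (t • (x + y))) (G t) := by
  obtain ⟨J, hJ, hJt⟩ := K.exists_strictTangent_exp_near_zero
  have hlim : Tendsto (fun a : ℝ => a • x) (𝓝 0) (𝓝 0) := by
    have h : Continuous fun a : ℝ => a • x := by fun_prop
    simpa using h.tendsto 0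
  have hsmall : ∀ᶠ a in 𝓝 (0 : ℝ), K.HasStrictTangent
      (fun y => (K.exp (a • x))⁻¹ * K.exp (a • (x + y))) (a • J (a • x)) := by
    filter_upwards [hlim.eventually hJt] with a ha
    have h := ha.comp_linear (a • ContinuousLinearMap.id ℝ E)
    convert h using 1
    · funext y; simp [smul_add]
    · ext y; simp
  -- Small parameters are settled; the addition formula for parameters reaches all others by
  -- repeated doubling.
  have hall : ∀ a : ℝ, ∃ L, K.HasStrictTangent
      (fun y => (K.exp (a • x))⁻¹ * K.exp (a • (x + y))) L := by
    intro a
    obtain ⟨n, hn⟩ := ((tendsto_two_pow_inv_smul a).eventually hsmall).exists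
    have key : ∀ k : ℕ, ∃ L, K.HasStrictTangent
        (fun y => (K.exp (((2 : ℝ) ^ k * (((2 : ℝ) ^ n)⁻¹ • a)) • x))⁻¹ *
          K.exp (((2 : ℝ) ^ k * (((2 : ℝ) ^ n)⁻¹ • a)) • (x + y))) L := by
      intro k
      induction k with
      | zero => exact ⟨_, by simpa using hn⟩
      | succ k ih =>
        obtain ⟨L, hL⟩ := ih
        have h := K.hasStrictTangent_exp_add_smul hL hL
        rw [← two_mul, ← mul_assoc, ← pow_succ'] at h
        exact ⟨_, h⟩
    have := key n
    rwa [smul_eq_mul, mul_inv_cancel_left₀ (by positivity)] at this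
  choose G hG using hall
  have hGsmall : ∀ᶠ a in 𝓝 (0 : ℝ), G a = a • J (a • x) :=
    hsmall.mono fun a ha => (hG a).hasTangent.unique ha.hasTangent
  have hG0 : G 0 = 0 := by simpa using hGsmall.self_of_nhds
  -- With this cocycle identity the derivative of `G` at `0` determines it everywhere.
  have hGadd : ∀ a b, G (a + b) = K.Ad (K.exp (b • x))⁻¹ * G a + G b := fun a b =>
    (hG (a + b)).hasTangent.unique (K.hasStrictTangent_exp_add_smul (hG a) (hG b)).hasTangent
  have hGd0 : HasDerivAt G 1 0 := by
    rw [hasDerivAt_iff_tendsto_slope_zero]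
    refine ((hJ.comp hlim).mono_left nhdsWithin_le_nhds).congr' ?_
    filter_upwards [self_mem_nhdsWithin, nhdsWithin_le_nhds hGsmall] with a ha ha'
    rw [zero_add, hG0, sub_zero, ha', smul_smul, inv_mul_cancel₀ ha, one_smul]
    rfl
  refine ⟨G, hG0, fun t => ?_, hG⟩
  have h1 : HasDerivAt (fun s => K.Ad (K.exp (t • x))⁻¹ * G (s - t) + G t)
      (K.Ad (K.exp (t • x))⁻¹ * 1) t := by
    refine HasDerivAt.add_const _ (HasDerivAt.const_mul _ ?_)
    apply HasDerivAt.comp_sub_const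
    rwa [sub_self]
  rw [mul_one] at h1
  refine h1.congr_of_eventuallyEq (Eventually.of_forall fun s => ?_)
  change G s = K.Ad (K.exp (t • x))⁻¹ * G (s - t) + G t
  rw [← hGadd, sub_add_cancel]

/-- The left-trivialized differential of the exponential map of a nilpotent group. -/
theorem hasStrictTangent_exp_add [CompleteSpace E] {c : ℕ}
    (hc : (⊤ : Subgroup N).lowerCentralSeries c = ⊥) (x : E) :
    K.HasStrictTangent (fun y => (K.exp x)⁻¹ * K.exp (x + y))
      (unipotentMean c (K.Ad (K.exp x)⁻¹)) := by
  obtain ⟨G, hG0, hG', hG⟩ := K.exists_dexp x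
  have hcont : Continuous fun t : ℝ => K.Ad (K.exp (t • x))⁻¹ :=
    K.continuous_Ad.comp (K.continuous_exp.comp (continuous_id.smul continuous_const)).inv
  -- Unipotence turns this integral into a polynomial in its value at `s = 1`, so the differential
  -- depends on `x` only through `exp x`.
  have h1 : ∫ s in (0 : ℝ)..1, K.Ad (K.exp (s • x))⁻¹ = G 1 - G 0 :=
    intervalIntegral.integral_eq_sub_of_hasDerivAt (fun s _ => hG' s)
      (hcont.intervalIntegrable _ _)
  have h2 := integral_eq_unipotentMean hcont
    (fun s t => by rw [← K.Ad_mul, ← mul_inv_rev, ← K.exp_add_smul, add_comm])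
    (by simp [K.exp_zero, K.Ad_one]) (c := c) (fun t => K.Ad_sub_one_pow_eq_zero hc _)
  rw [hG0, sub_zero, h2, one_smul] at h1
  have := hG 1
  rw [← h1] at this
  simpa using this

/-- A one-parameter group of unipotents is determined by its value at `1`. -/
theorem Ad_exp_smul_eq {c : ℕ} (hc : (⊤ : Subgroup N).lowerCentralSeries c = ⊥) {x y : E}
    (h : K.exp x = K.exp y) (t : ℝ) : K.Ad (K.exp (t • x)) = K.Ad (K.exp (t • y)) := by
  have key : ∀ x y : E, K.exp x = K.exp y → ∀ t : ℝ, 0 ≤ t →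
      K.Ad (K.exp (t • x)) = K.Ad (K.exp (t • y)) := by
    intro x y h t ht
    have hp : ∀ z : E, K.Ad (K.exp (t • z)) =
        ∑ j ∈ Finset.range c, binomialCoeff j t • (K.Ad (K.exp z) - 1) ^ j := by
      intro z
      have := eq_sum_binomialCoeff (f := fun t : ℝ => K.Ad (K.exp (t • z)))
        (K.continuous_Ad.comp (K.continuous_exp.comp (continuous_id.smul continuous_const)))
        (fun s t => by rw [← K.Ad_mul, ← K.exp_add_smul])
        (by simp [K.exp_zero, K.Ad_one]) (fun t => K.Ad_sub_one_pow_eq_zero hc _) ht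
      simpa using this
    rw [hp, hp, h]
  rcases le_total 0 t with ht | ht
  · exact key x y h t ht
  · have := key (-x) (-y) (by rw [K.exp_neg, K.exp_neg, h]) (-t) (by linarith)
    simpa using this

end CanonicalCoordinates

theorem AddSubgroup.discreteTopology_of_eventually {A : Type*} [AddGroup A] [TopologicalSpace A]
    [IsTopologicalAddGroup A] {S : AddSubgroup A} (h : ∀ᶠ z in nhds (0 : A), z ∈ S → z = 0) :
    DiscreteTopology S := by
  refine discreteTopology_of_isOpen_singleton_zero ?_
  rw [isOpen_singleton_iff_nhds_eq_pure]
  refine le_antisymm ?_ (pure_le_nhds _)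
  rw [Filter.le_pure_iff, nhds_induced, S.coe_zero]
  filter_upwards [Filter.preimage_mem_comap h] with z hz
  exact Subtype.ext (hz z.2)

/-! ### Surjectivity, covering property and injectivity of the exponential map -/

namespace CanonicalCoordinates

set_option linter.unusedSectionVars false

open Filter Topology

variable {E N : Type*} [NormedAddCommGroup E] [NormedSpace ℝ E] [CompleteSpace E] [Group N]
  [TopologicalSpace N] [IsTopologicalGroup N] (K : CanonicalCoordinates E N) {c : ℕ}

/-- The inverse of the left-trivialized differential of the exponential map of a nilpotent group,
as a function of the point of the group. -/
noncomputable def dlog (c : ℕ) (g : N) : E →L[ℝ] E :=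
  Ring.inverse (unipotentMean c (K.Ad g⁻¹))

theorem isUnit_unipotentMean_Ad (hc : (⊤ : Subgroup N).lowerCentralSeries c = ⊥) (g : N) :
    IsUnit (unipotentMean c (K.Ad g)) :=
  isUnit_unipotentMean (K.Ad_sub_one_pow_eq_zero hc g)

theorem continuous_dlog (hc : (⊤ : Subgroup N).lowerCentralSeries c = ⊥) :
    Continuous (K.dlog c) := by
  rw [continuous_iff_continuousAt]
  intro g
  obtain ⟨u, hu⟩ := K.isUnit_unipotentMean_Ad hc g⁻¹
  have h1 : ContinuousAt Ring.inverse (unipotentMean c (K.Ad g⁻¹)) := by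
    rw [← hu]
    exact NormedRing.inverse_continuousAt u
  exact ContinuousAt.comp (f := fun g : N => unipotentMean c (K.Ad g⁻¹)) h1
    ((continuous_unipotentMean c).comp (K.continuous_Ad.comp continuous_inv)).continuousAt

/-- A local logarithm around `exp x`, in left-translated coordinates. -/
theorem exists_local_log (hc : (⊤ : Subgroup N).lowerCentralSeries c = ⊥) (x : E) :
    ∃ ψ : E → E, ψ 0 = 0 ∧ HasFDerivAt ψ (K.dlog c (K.exp x)) 0 ∧
      (∀ᶠ z in 𝓝 0, ContinuousAt ψ z) ∧ (∀ᶠ z in 𝓝 0, K.exp (x + ψ z) = K.exp x * K.exp z) ∧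
      ∀ᶠ w in 𝓝 0, ψ (K.chart ((K.exp x)⁻¹ * K.exp (x + w))) = w := by
  obtain ⟨u, hu⟩ := K.isUnit_unipotentMean_Ad hc (K.exp x)⁻¹
  have ht := K.hasStrictTangent_exp_add hc x
  have hd := ht.hasStrictFDerivAt
  rw [← hu] at hd
  have hd' : HasStrictFDerivAt (fun w => K.chart ((K.exp x)⁻¹ * K.exp (x + w)))
    (ContinuousLinearEquiv.ofUnit u : E →L[ℝ] E) 0 := hd
  have h0 : K.chart ((K.exp x)⁻¹ * K.exp (x + 0)) = 0 := ht.hasTangent.chart_zero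
  have h1 := hd'.to_localInverse
  have h2 := hd'.localInverse_apply_image
  have h3 := hd'.eventually_right_inverse
  have h4 := hd'.localInverse_tendsto
  have h5 : ∀ᶠ z in 𝓝 (K.chart ((K.exp x)⁻¹ * K.exp (x + 0))),
      ContinuousAt (hd'.localInverse _ _ _) z := by
    filter_upwards [(hd'.toOpenPartialHomeomorph _).open_target.mem_nhds
      hd'.image_mem_toOpenPartialHomeomorph_target] with z hz
    exact (hd'.toOpenPartialHomeomorph _).continuousAt_symm hz
  simp only [h0] at h1 h2 h3 h4 h5
  refine ⟨hd'.localInverse _ _ _, h2, ?_, h5, ?_, hd'.eventually_left_inverse⟩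
  · rw [dlog, ← hu, Ring.inverse_unit]
    exact h1.hasFDerivAt
  · filter_upwards [h3, (ht.tendsto.comp h4).eventually K.eventually_exp_chart] with z hz hz'
    simp only [Function.comp_apply] at hz'
    rw [hz] at hz'
    rw [hz', mul_inv_cancel_left]

theorem hasDerivAt_lift (hc : (⊤ : Subgroup N).lowerCentralSeries c = ⊥) {X : ℝ → E} {y : E}
    {g : N} {t : ℝ} (hX : ContinuousAt X t) (h : ∀ᶠ s in 𝓝 t, K.exp (X s) = g * K.exp (s • y)) :
    HasDerivAt X (K.dlog c (g * K.exp (t • y)) y) t := by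
  obtain ⟨ψ, hψ0, hψ, -, -, hψl⟩ := K.exists_local_log hc (X t)
  rw [← h.self_of_nhds]
  have h1 : HasDerivAt (fun s : ℝ => (s - t) • y) y t := by
    simpa using ((hasDerivAt_id t).sub_const t).smul_const y
  have hψ' : HasFDerivAt ψ (K.dlog c (K.exp (X t))) ((t - t) • y) := by simpa using hψ
  refine ((hψ'.comp_hasDerivAt t h1).const_add (X t)).congr_of_eventuallyEq ?_
  have h2 : Tendsto (fun s => X s - X t) (𝓝 t) (𝓝 0) := by
    simpa using hX.tendsto.sub_const (X t)
  have h3 : Tendsto (fun s : ℝ => (s - t) • y) (𝓝 t) (𝓝 0) := by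
    simpa using h1.continuousAt.tendsto
  filter_upwards [h2.eventually hψl, h3.eventually K.eventually_chart_exp, h] with s hs1 hs2 hs3
  have e : (K.exp (X t))⁻¹ * K.exp (X t + (X s - X t)) = K.exp ((s - t) • y) := by
    rw [add_sub_cancel, hs3, h.self_of_nhds, sub_eq_neg_add, K.exp_add_smul, neg_smul, K.exp_neg]
    group
  rw [e, hs2] at hs1
  simp [hs1]

/-- A lift has derivative `dlog` along the known curve in `N`, a function of `t` alone; so it is a
plain integral, with no question of global existence. The times at which the integral lifts the
curve form a clopen set. -/
theorem exists_lift [T2Space N] (hc : (⊤ : Subgroup N).lowerCentralSeries c = ⊥) (x y : E) :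
    ∃ X : ℝ → E, ∀ t, K.exp (X t) = K.exp x * K.exp (t • y) := by
  have hsm : Continuous fun t : ℝ => t • y := by fun_prop
  have hg : Continuous fun t : ℝ => K.exp x * K.exp (t • y) :=
    continuous_const.mul (K.continuous_exp.comp hsm)
  have hd : Continuous fun t : ℝ => K.dlog c (K.exp x * K.exp (t • y)) y :=
    ((K.continuous_dlog hc).comp hg).clm_apply continuous_const
  let X : ℝ → E := fun t => x + ∫ s in (0 : ℝ)..t, K.dlog c (K.exp x * K.exp (s • y)) y
  have hX : ∀ t, HasDerivAt X (K.dlog c (K.exp x * K.exp (t • y)) y) t := fun t =>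
    (hd.integral_hasStrictDerivAt 0 t).hasDerivAt.const_add x
  have hXc : Continuous X := continuous_iff_continuousAt.2 fun t => (hX t).continuousAt
  have hclosed : IsClosed {t | K.exp (X t) = K.exp x * K.exp (t • y)} :=
    isClosed_eq (K.continuous_exp.comp hXc) hg
  have hopen : IsOpen {t | K.exp (X t) = K.exp x * K.exp (t • y)} := by
    rw [isOpen_iff_mem_nhds]
    intro t₀ ht₀
    obtain ⟨ψ, hψ0, -, hψc, hψr, -⟩ := K.exists_local_log hc (X t₀)
    have h1 : Tendsto (fun t : ℝ => (t - t₀) • y) (𝓝 t₀) (𝓝 0) := by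
      have h : Continuous fun t : ℝ => (t - t₀) • y := by fun_prop
      simpa using h.tendsto t₀
    have h2 : ∀ᶠ t in 𝓝 t₀, K.exp (X t₀ + ψ ((t - t₀) • y)) = K.exp x * K.exp (t • y) := by
      filter_upwards [h1.eventually hψr] with t ht
      rw [ht, ht₀, mul_assoc, ← K.exp_add_smul, add_sub_cancel]
    have h3 : ∀ᶠ t in 𝓝 t₀, HasDerivAt (fun s => X t₀ + ψ ((s - t₀) • y))
        (K.dlog c (K.exp x * K.exp (t • y)) y) t := by
      filter_upwards [h1.eventually hψc, h2.eventually_nhds] with t ht ht'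
      refine K.hasDerivAt_lift hc (continuousAt_const.add ?_) ht'
      exact ContinuousAt.comp (f := fun s : ℝ => (s - t₀) • y) ht (by fun_prop)
    obtain ⟨ε, hε, hb⟩ := Metric.eventually_nhds_iff_ball.1 (h2.and h3)
    filter_upwards [Metric.ball_mem_nhds t₀ hε] with t ht
    have heq : Set.EqOn (fun s => X t₀ + ψ ((s - t₀) • y)) X (Metric.ball t₀ ε) :=
      Metric.isOpen_ball.eqOn_of_deriv_eq (convex_ball t₀ ε).isPreconnected
        (fun s hs => (hb s hs).2.differentiableAt.differentiableWithinAt)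
        (fun s _ => (hX s).differentiableAt.differentiableWithinAt)
        (fun s hs => (hb s hs).2.deriv.trans (hX s).deriv.symm)
        (Metric.mem_ball_self hε) (by simp [hψ0])
    have := (hb t ht).1
    rwa [show X t₀ + ψ ((t - t₀) • y) = X t from heq ht] at this
  have huniv := IsClopen.eq_univ ⟨hclosed, hopen⟩ ⟨0, by simp [X, K.exp_zero]⟩
  exact ⟨X, fun t => huniv.ge (Set.mem_univ t)⟩

/-- Lifting curves makes the image of `exp` a subgroup; it contains a neighbourhood of `1`, and `N`
is connected. -/
theorem exp_surjective [T2Space N] [PreconnectedSpace N]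
    (hc : (⊤ : Subgroup N).lowerCentralSeries c = ⊥) : Function.Surjective K.exp := by
  let S : Subgroup N :=
    { carrier := Set.range K.exp
      one_mem' := ⟨0, K.exp_zero⟩
      mul_mem' := by
        rintro _ _ ⟨x, rfl⟩ ⟨y, rfl⟩
        obtain ⟨X, hX⟩ := K.exists_lift hc x y
        exact ⟨X 1, by simpa using hX 1⟩
      inv_mem' := by
        rintro _ ⟨x, rfl⟩
        exact ⟨-x, K.exp_neg x⟩ }
  have hopen : IsOpen (S : Set N) := by
    refine S.isOpen_of_mem_nhds (g := 1) ?_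
    filter_upwards [K.eventually_exp_chart] with g hg
    exact ⟨_, hg⟩
  have huniv : (S : Set N) = Set.univ :=
    IsClopen.eq_univ ⟨S.isClosed_of_isOpen hopen, hopen⟩ ⟨1, S.one_mem⟩
  exact Set.range_eq_univ.1 huniv

theorem isOpenMap_exp (hc : (⊤ : Subgroup N).lowerCentralSeries c = ⊥) : IsOpenMap K.exp := by
  rw [isOpenMap_iff_nhds_le]
  intro x s hs
  obtain ⟨ψ, hψ0, -, hψc, hψr, -⟩ := K.exists_local_log hc x
  have h1 : Tendsto (fun g => (K.exp x)⁻¹ * g) (𝓝 (K.exp x)) (𝓝 1) := by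
    simpa using (continuous_const_mul (K.exp x)⁻¹).tendsto (K.exp x)
  have h2 := K.tendsto_chart.comp h1
  have h3 : Tendsto (fun z => x + ψ z) (𝓝 0) (𝓝 x) := by
    simpa [hψ0] using hψc.self_of_nhds.tendsto.const_add x
  filter_upwards [(h3.comp h2).eventually hs, h2.eventually hψr,
    h1.eventually K.eventually_exp_chart] with g hg1 hg2 hg3
  simp only [Function.comp_apply] at hg1 hg2
  rw [hg3, mul_inv_cancel_left] at hg2
  rw [hg2] at hg1
  exact hg1

/-- Two elements with the same exponential differ by a period of the exponential map. -/
theorem exp_add_sub_of_exp_eq (hc : (⊤ : Subgroup N).lowerCentralSeries c = ⊥)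
    (hsurj : Function.Surjective K.exp) {x y : E} (h : K.exp x = K.exp y) (z : E) :
    K.exp (z + (x - y)) = K.exp z := by
  let A : ℝ →L[ℝ] E := ContinuousLinearMap.toSpanSingleton ℝ x
  let B : ℝ →L[ℝ] E := ContinuousLinearMap.toSpanSingleton ℝ (-y)
  let u : ℝ → N := fun t => K.exp (A t) * K.exp (B t)
  have hu : ∀ t, u t = K.exp (t • x) * (K.exp (t • y))⁻¹ := fun t => by
    simp [u, A, B, K.exp_neg]
  -- Equality of `exp x` and `exp y` forces equality of `Ad` along both rays, so `u t` is central;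
  -- then `u` commutes with doubling and equals `exp (t • (x - y))`.
  have hAd : ∀ t, K.Ad (u t) = 1 := fun t => by
    rw [hu, K.Ad_mul, K.Ad_exp_smul_eq hc h, ← K.Ad_mul, mul_inv_cancel, K.Ad_one]
  have hcomm : ∀ t g, Commute (u t) g := by
    intro t g
    obtain ⟨w, rfl⟩ := hsurj g
    have := K.conj_exp (u t) w
    rw [hAd, one_apply_eq_self, mul_inv_eq_iff_eq_mul] at this
    exact this
  have h2 : ∀ t : ℝ, u ((2 : ℝ) • t) = u t * u t := by
    intro t
    calc u ((2 : ℝ) • t) = K.exp (t • x) * u t * (K.exp (t • y))⁻¹ := by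
          rw [hu, hu, smul_assoc, smul_assoc, K.exp_two_smul, K.exp_two_smul]
          group
      _ = u t * (K.exp (t • x) * (K.exp (t • y))⁻¹) := by
          rw [← (hcomm t _).eq, mul_assoc]
      _ = u t * u t := by rw [← hu]
  have h3 : ∀ t : ℝ, u t = K.exp (t • (x - y)) := fun t => by
    have h : u t = K.exp ((A + B) t) :=
      ((K.hasTangent_exp A).mul (K.hasTangent_exp B)).eq_exp h2 t
    rw [h]
    simp [A, B, sub_eq_add_neg]
  have h4 : K.exp (x - y) = 1 := by
    have := h3 1
    rw [hu, one_smul, one_smul, one_smul, h, mul_inv_cancel] at this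
    exact this.symm
  rw [K.exp_add_of_commute (fun r => by rw [← h3]; exact (hcomm r _).symm), h4, mul_one]

/-- The exponential map of a connected nilpotent Lie group is a covering map. -/
theorem isCoveringMap_exp [T2Space N] [PreconnectedSpace N]
    (hc : (⊤ : Subgroup N).lowerCentralSeries c = ⊥) : IsCoveringMap K.exp := by
  have hsurj := K.exp_surjective hc
  -- The group of periods: its cosets are the fibres of `exp`, and it is discrete since `exp` is
  -- injective near `0`.
  let Λ : AddSubgroup E :=
    { carrier := {z | ∀ x, K.exp (x + z) = K.exp x}
      zero_mem' := fun x => by rw [add_zero]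
      add_mem' := fun {a b} ha hb x => by rw [← add_assoc, hb, ha]
      neg_mem' := fun {a} ha x => by rw [← ha (x + -a), neg_add_cancel_right] }
  have hq : IsQuotientMap K.exp := (K.isOpenMap_exp hc).isQuotientMap K.continuous_exp hsurj
  have hdisc : IsDiscrete (Λ : Set E) := by
    refine ⟨AddSubgroup.discreteTopology_of_eventually ?_⟩
    filter_upwards [K.eventually_chart_exp] with z hz hzΛ
    have h0 := hzΛ 0
    rw [zero_add] at h0
    rw [← hz, h0, K.eventually_chart_exp.self_of_nhds]
  refine (hq.isAddQuotientCoveringMap_of_addSubgroup Λ hdisc fun {x y} => ?_).isCoveringMap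
  constructor
  · intro h z
    rw [← sub_eq_add_neg]
    exact K.exp_add_sub_of_exp_eq hc hsurj h.symm z
  · intro h
    have := h x
    rw [add_comm y, add_neg_cancel_left] at this
    exact this.symm

/-- A path joining two points of a fibre maps to a null-homotopic loop, and lifts of such loops are
closed. -/
theorem exp_injective [T2Space N] [SimplyConnectedSpace N]
    (hc : (⊤ : Subgroup N).lowerCentralSeries c = ⊥) : Function.Injective K.exp := by
  have cov := K.isCoveringMap_exp hc
  intro x y h
  let γ : Path x y := (PathConnectedSpace.joined x y).somePath
  let γ₁ : Path (K.exp x) (K.exp x) := (γ.map K.continuous_exp).cast rfl h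
  have hhom : ContinuousMap.HomotopicRel (γ₁ : C(unitInterval, N))
      (ContinuousMap.const unitInterval (K.exp x)) {0, 1} :=
    SimplyConnectedSpace.paths_homotopic γ₁ (Path.refl _)
  have h1 := cov.liftPath_apply_one_eq_of_homotopicRel hhom x (by simp) (by simp)
  rw [cov.liftPath_const] at h1
  have h2 : (γ : C(unitInterval, E)) = cov.liftPath (γ₁ : C(unitInterval, N)) x (by simp) :=
    (cov.eq_liftPath_iff' _).2 ⟨rfl, by simp⟩
  rw [← h2] at h1
  simpa using h1.symm

end CanonicalCoordinates

/-! ### Discrete subgroups when the exponential map is bijective -/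

namespace CanonicalCoordinates

set_option linter.unusedSectionVars false

open Filter Topology

variable {E N : Type*} [NormedAddCommGroup E] [NormedSpace ℝ E] [Group N]
  [TopologicalSpace N] [IsTopologicalGroup N] (K : CanonicalCoordinates E N)

theorem eq_one_of_pow_eq_one (hK : Function.Bijective K.exp) (g : N) (n : ℕ) (hn : n ≠ 0)
    (h : g ^ n = 1) : g = 1 := by
  obtain ⟨x, rfl⟩ := hK.2 g
  rw [← K.exp_nsmul, ← K.exp_zero] at h
  have hx : x = 0 := by simpa [hn] using hK.1 h
  rw [hx, K.exp_zero]

/-- By injectivity `Ad g` fixes `y`, hence the whole line through it. -/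
theorem commute_exp_smul_right (hinj : Function.Injective K.exp) {g : N} {y : E}
    (h : Commute g (K.exp y)) (t : ℝ) : Commute g (K.exp (t • y)) := by
  have h1 := K.conj_exp g y
  rw [h.eq, mul_inv_cancel_right] at h1
  have h2 := K.conj_exp g (t • y)
  rw [map_smul, ← hinj h1, mul_inv_eq_iff_eq_mul] at h2
  exact h2

theorem exp_add_of_commute_exp (hinj : Function.Injective K.exp) {x y : E}
    (h : Commute (K.exp x) (K.exp y)) : K.exp (x + y) = K.exp x * K.exp y :=
  K.exp_add_of_commute fun r =>
    (K.commute_exp_smul_right hinj (K.commute_exp_smul_right hinj h r).symm r).symm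

/-- Commutative subgroups of a discrete subgroup are finitely generated when the exponential map
is bijective. -/
theorem fg_of_commute [FiniteDimensional ℝ E] (hK : Function.Bijective K.exp) {Γ : Subgroup N}
    [DiscreteTopology Γ] (B : Subgroup Γ) (hB : ∀ x ∈ B, ∀ y ∈ B, Commute x y) : B.FG := by
  have hcomm : ∀ {x y : E} {a b : Γ}, a ∈ B → b ∈ B → (a : N) = K.exp x → (b : N) = K.exp y →
      Commute (K.exp x) (K.exp y) := by
    intro x y a b ha hb hax hby
    rw [← hax, ← hby]
    exact (hB a ha b hb).map Γ.subtype
  -- The logarithms of `B`: closed under addition as `B` is commutative, discrete as `Γ` is, hence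
  -- finitely generated, and `exp` maps them homomorphically onto `B`.
  let S : AddSubgroup E :=
    { carrier := {x | ∃ b ∈ B, (b : N) = K.exp x}
      zero_mem' := ⟨1, B.one_mem, K.exp_zero.symm⟩
      add_mem' := by
        rintro x y ⟨a, ha, hax⟩ ⟨b, hb, hby⟩
        refine ⟨a * b, B.mul_mem ha hb, ?_⟩
        rw [K.exp_add_of_commute_exp hK.1 (hcomm ha hb hax hby), ← hax, ← hby, Subgroup.coe_mul]
      neg_mem' := by
        rintro x ⟨a, ha, hax⟩
        exact ⟨a⁻¹, B.inv_mem ha, by rw [K.exp_neg, ← hax, Subgroup.coe_inv]⟩ }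
  have hdisc : DiscreteTopology S := by
    refine AddSubgroup.discreteTopology_of_eventually ?_
    have hΓ : ∀ᶠ g in 𝓝 (1 : N), g ∈ Γ → g = 1 := by
      have h1 : ({1} : Set Γ) ∈ 𝓝 (1 : Γ) := (isOpen_discrete _).mem_nhds rfl
      rw [nhds_induced, mem_comap] at h1
      obtain ⟨U, hU, hU'⟩ := h1
      filter_upwards [hU] with g hg hgΓ
      exact congrArg Subtype.val (hU' (a := ⟨g, hgΓ⟩) hg)
    filter_upwards [K.tendsto_exp.eventually hΓ] with z hz hzS
    obtain ⟨b, -, hbz⟩ := hzS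
    refine hK.1 ?_
    rw [hz (hbz ▸ b.2), K.exp_zero]
  have hfin : Module.Finite ℤ (AddSubgroup.toIntSubmodule S) :=
    haveI : DiscreteTopology (AddSubgroup.toIntSubmodule S) := hdisc
    inferInstance
  have hfg : AddGroup.FG S := Module.Finite.iff_addGroup_fg.1 hfin
  let φ : Multiplicative S →* Γ :=
    { toFun := fun x => ⟨K.exp x.toAdd, by
        obtain ⟨b, -, hb⟩ := x.toAdd.2
        exact hb ▸ b.2⟩
      map_one' := Subtype.ext K.exp_zero
      map_mul' := by
        rintro ⟨x, a, ha, hax⟩ ⟨y, b, hb, hby⟩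
        exact Subtype.ext (K.exp_add_of_commute_exp hK.1 (hcomm ha hb hax hby)) }
  have hφ : φ.range = B := by
    ext g
    constructor
    · rintro ⟨⟨x, a, ha, hax⟩, rfl⟩
      have : φ (Multiplicative.ofAdd ⟨x, a, ha, hax⟩) = a := Subtype.ext hax.symm
      rwa [← this] at ha
    · intro hg
      obtain ⟨x, hx⟩ := hK.2 (g : N)
      exact ⟨Multiplicative.ofAdd ⟨x, g, hg, hx.symm⟩, Subtype.ext hx⟩
  rw [← hφ, ← Group.fg_iff_subgroup_fg]
  exact Group.fg_range φ

end CanonicalCoordinates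

/-- A simply connected nilpotent Lie group has canonical coordinates whose exponential map is
bijective. -/
theorem exists_canonicalCoordinates_bijective_exp {E : Type*} [NormedAddCommGroup E]
    [NormedSpace ℝ E] [CompleteSpace E] {N : Type*} [Group N] [TopologicalSpace N]
    [ChartedSpace E N] [T2Space N] [LieGroup 𝓘(ℝ, E) ∞ N] [IsTopologicalGroup N]
    [SimplyConnectedSpace N] [Group.IsNilpotent N] :
    ∃ K : CanonicalCoordinates E N, Function.Bijective K.exp := by
  obtain ⟨K⟩ := exists_canonicalCoordinates (E := E) (N := N)
  obtain ⟨c, hc⟩ := Subgroup.nilpotent_iff_lowerCentralSeries.1 ‹Group.IsNilpotent N›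
  exact ⟨K, K.exp_injective hc, K.exp_surjective hc⟩

theorem proposition4p1 {E : Type*} [NormedAddCommGroup E] [NormedSpace ℝ E]
    [FiniteDimensional ℝ E] {N : Type*} [Group N] [TopologicalSpace N] [ChartedSpace E N]
    [T2Space N] [SecondCountableTopology N] [LieGroup 𝓘(ℝ, E) ∞ N] [SimplyConnectedSpace N]
    [Group.IsNilpotent N] (Γ : Subgroup N) (hΓ : Γ.IsLatticeIn) :
    (∀ k : ℕ, (Subgroup.upperCentralSeries Γ k).IsStronglyCommensuristic) ∧
      ∀ k : ℕ, ((⊤ : Subgroup Γ).lowerCentralSeries k).IsCommensuristic := by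
  have : CompleteSpace E := FiniteDimensional.complete ℝ E
  have : IsTopologicalGroup N := topologicalGroup_of_lieGroup 𝓘(ℝ, E) ∞
  have : DiscreteTopology Γ := hΓ.discrete
  obtain ⟨K, hK⟩ := exists_canonicalCoordinates_bijective_exp (E := E) (N := N)
  refine ⟨upperCentralSeries_isStronglyCommensuristic fun x n hn hx => Subtype.ext ?_,
    lowerCentralSeries_isCommensuristic
      (Subgroup.fg_of_forall_abelian_fg fun B hB => K.fg_of_commute hK B hB)⟩
  exact K.eq_one_of_pow_eq_one hK _ n hn (congrArg Subtype.val hx)
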